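/- Let $n\ge 1$ agents have valuations $v_i:2^{[m]}\to\mathbb{R}_+$, $i\in[n]$, over $m$ indivisible goods, each nonnegative, monotone and submodular with $v_i(\emptyset)=0$. An allocation is a partition $(P_1,\dots,P_n)$ of $[m]$ into $n$ (possibly empty) bundles, and $\mu_i=\max_{(M_1,\dots,M_n)}\min_{k\in[n]} v_i(M_k)$, the maximum over all allocations, is the maximin share of agent $i$. For a factor $c>0$, thresholds $\tau_i$ and a set of agents $A$, $\textsc{RoundRobin}$ works as follows. As long as there are an agent $i\in A$ and an unallocated good $j$ with $v_i(\{j\})\ge c\,\tau_i$, it gives such a good $j$ to such an agent $i$ as her bundle and removes $i$ from $A$. Then, in a fixed order and cyclically, the agents left in $A$ each pick an unallocated good $g$ that maximizes $v_i(P_i\cup\{g\})-v_i(P_i)$, until no good is left; if no agent is left in $A$, the unallocated goods are added to arbitrary bundles. For $\delta>0$, $\textsc{AlgSub}$ sets aside the agents with $\mu_i=0$, starts with $\tau_i=v_i([m])$ and $P_i=\emptyset$, and, as long as the set $V$ of the remaining agents with $v_i(P_i)<c\,\tau_i$ is nonempty, replaces $\tau_i$ by $\tau_i/(1+\delta)$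 for all $i\in V$ and lets $(P_1,\dots,P_n)$ be the result of $\textsc{RoundRobin}$ for the remaining agents and the current thresholds. It returns $(P_1,\dots,P_n)$ when $V=\emptyset$ (an arbitrary allocation if all agents have been set aside). Then there is a rational constant $\delta_0\in(0,1)$ such that, for every rational $\delta\in(0,\delta_0]$, $\textsc{AlgSub}$ with factor $c=(1+\delta)/10$ finds in polynomial time, with oracle access to the valuations, an allocation with $v_i(P_i)\ge\frac{1}{10}\mu_i$ for all $i\in[n]$. With factor $c=1/10$ and any rational $\delta\in(0,1)$, it finds in polynomial time an allocation with $v_i(P_i)\ge\frac{1}{10(1+\delta)}\mu_i$ for all $i\in[n]$. In particular, an allocation with $v_i(P_i)\ge\frac{1}{10}\mu_i$ for all $i\in[n]$ always exists. Here "finds in polynomial time" means the following, for fixed $\delta$. However the arbitrary choices are made, the execution does not get stuck, it ends after at most $\sum_{i:\mu_i>0}\bigl(1+\log_{1+\delta}(v_i([m])/\mu_i)\bigr)$ iterations, and the returned allocation has the stated property. Moreover, a single program with a value oracle for the $v_i$ computes, for every instance, an allocation that $\textsc{AlgSub}$ can return, and its running time is polynomial in $n$, $m$ and $\sum_{i:\mu_i>0}\lceil\log_2(v_i([m])/\mu_i)\rceil$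 when operations on real numbers and oracle calls on them are charged independently of the size of the numbers; if all values $v_i(S)$ are rational, with numerators and denominators of at most $L$ bits in total for each value, then its running time with all operations charged by the bit lengths of the numbers involved is polynomial in $n$, $m$ and $L$. -/

import Mathlib

namespace MMS

/-! Fair division instances: `n` agents, `m` indivisible goods, valuations given on all bundles. -/

/-- Nonnegative, monotone, submodular valuations (normalized by `v ∅ = 0`). -/
structure IsValuation {m : ℕ} (v : Finset (Fin m) → ℝ) : Prop where
  empty : v ∅ = 0
  nonneg : ∀ S, 0 ≤ v S
  mono : ∀ A B, A ⊆ B → v A ≤ v B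
  submod : ∀ A B g, A ⊆ B → g ∉ B → v (insert g B) - v B ≤ v (insert g A) - v A

/-- `A` is an `n`-partition of the set `S` of goods (bundles may be empty). -/
def IsPartition {n m : ℕ} (S : Finset (Fin m)) (A : Fin n → Finset (Fin m)) : Prop :=
  (∀ i j, i ≠ j → Disjoint (A i) (A j)) ∧ Finset.univ.biUnion A = S

/-- The `n`-maximin share of the goods `S` under `v`: the maximum over all `n`-partitions of `S` of
the minimum value of a bundle. (For `1 ≤ n` both extrema are over finite nonempty sets.) -/
noncomputable def maximinShare (n : ℕ) {m : ℕ} (v : Finset (Fin m) → ℝ) (S : Finset (Fin m)) : ℝ :=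
  sSup {x | ∃ A : Fin n → Finset (Fin m), IsPartition S A ∧ x = ⨅ k, v (A k)}

/-- The maximin share `μ_i` of agent `i` in the instance `v`. -/
noncomputable def share {n m : ℕ} (v : Fin n → Finset (Fin m) → ℝ) (i : Fin n) : ℝ :=
  maximinShare n (v i) Finset.univ

/-! The algorithm RoundRobin, with all its arbitrary choices left open. -/

/-- A state of RoundRobin: the agents `A` still present, the unallocated goods `G`, and the bundles
`P_i` built so far. -/
structure RRState (n m : ℕ) where
  agents : Finset (Fin n)
  goods : Finset (Fin m)
  bundle : Fin n → Finset (Fin m)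

/-- The first while-loop: as long as some present agent `i` values some unallocated good `j` at
`c * τ_i` or more, such an agent gets such a good as her only good and leaves. -/
inductive SingletonPhase {n m : ℕ} (c : ℝ) (v : Fin n → Finset (Fin m) → ℝ) (τ : Fin n → ℝ) :
    RRState n m → RRState n m → Prop
  | finish (s : RRState n m) (h : ∀ i ∈ s.agents, ∀ j ∈ s.goods, v i {j} < c * τ i) :
      SingletonPhase c v τ s s
  | step (s t : RRState n m) (i : Fin n) (j : Fin m) (hi : i ∈ s.agents) (hj : j ∈ s.goods)
      (h : c * τ i ≤ v i {j})
      (ht : SingletonPhase c v τ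
        ⟨s.agents.erase i, s.goods.erase j, Function.update s.bundle i {j}⟩ t) :
      SingletonPhase c v τ s t

/-- One round: the agents in the list choose, in this order, an unallocated good of maximum
marginal value for them; the round is cut short when no good is left. -/
inductive Round {n m : ℕ} (v : Fin n → Finset (Fin m) → ℝ) :
    List (Fin n) → RRState n m → RRState n m → Prop
  | nil (s : RRState n m) : Round v [] s s
  | exhausted (l : List (Fin n)) (s : RRState n m) (h : s.goods = ∅) : Round v l s s
  | pick (i : Fin n) (l : List (Fin n)) (s t : RRState n m) (g : Fin m) (hg : g ∈ s.goods)
      (hmax : ∀ j ∈ s.goods, v i (insert j (s.bundle i)) - v i (s.bundle i) ≤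
        v i (insert g (s.bundle i)) - v i (s.bundle i))
      (ht : Round v l
        ⟨s.agents, s.goods.erase g, Function.update s.bundle i (insert g (s.bundle i))⟩ t) :
      Round v (i :: l) s t

/-- The second while-loop: rounds are repeated until all goods are allocated (there is nothing to
repeat if no agent is present). -/
inductive GreedyPhase {n m : ℕ} (v : Fin n → Finset (Fin m) → ℝ) (l : List (Fin n)) :
    RRState n m → RRState n m → Prop
  | finish (s : RRState n m) (h : s.goods = ∅ ∨ l = []) : GreedyPhase v l s s
  | round (s t u : RRState n m) (hs : s.goods.Nonempty) (hl : l ≠ []) (hr : Round v l s t)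
      (hu : GreedyPhase v l t u) : GreedyPhase v l s u

/-- `P` is a possible result of RoundRobin with thresholds `τ` and factor `c`, run for the agents
in `A₀`. The remaining agents are enumerated in an arbitrary order `l` for the second loop. Goods
that are still unallocated when no agent is left are added to arbitrary bundles; if the second loop
has allocated all goods, then `P` is exactly the allocation it has built. -/
def RoundRobin {n m : ℕ} (c : ℝ) (v : Fin n → Finset (Fin m) → ℝ) (A₀ : Finset (Fin n))
    (τ : Fin n → ℝ) (P : Fin n → Finset (Fin m)) : Prop :=
  ∃ (s t : RRState n m) (l : List (Fin n)),
    SingletonPhase c v τ ⟨A₀, Finset.univ, fun _ => ∅⟩ s ∧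
    l.Nodup ∧ l.toFinset = s.agents ∧ GreedyPhase v l s t ∧
    IsPartition Finset.univ P ∧ ∀ i, t.bundle i ⊆ P i

/-! The algorithm AlgSub. -/

/-- The agents that are kept: those whose maximin share is positive. -/
noncomputable def active {n m : ℕ} (v : Fin n → Finset (Fin m) → ℝ) : Finset (Fin n) := by
  classical exact Finset.univ.filter fun i => 0 < share v i

/-- The set `V` of (kept) agents with `v_i(P_i) < c * τ_i`. -/
noncomputable def unsatisfied {n m : ℕ} (c : ℝ) (v : Fin n → Finset (Fin m) → ℝ) (τ : Fin n → ℝ)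
    (P : Fin n → Finset (Fin m)) : Finset (Fin n) := by
  classical exact (active v).filter fun i => v i (P i) < c * τ i

/-- `Reaches c δ v k τ P`: some execution of AlgSub has thresholds `τ` and bundles `P` after `k`
iterations of its while-loop. -/
inductive Reaches {n m : ℕ} (c δ : ℝ) (v : Fin n → Finset (Fin m) → ℝ) :
    ℕ → (Fin n → ℝ) → (Fin n → Finset (Fin m)) → Prop
  | start : Reaches c δ v 0 (fun i => v i Finset.univ) (fun _ => ∅)
  | iterate (k : ℕ) (τ τ' : Fin n → ℝ) (P P' : Fin n → Finset (Fin m)) (h : Reaches c δ v k τ P)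
      (hV : (unsatisfied c v τ P).Nonempty)
      (hin : ∀ i ∈ unsatisfied c v τ P, τ' i = 1 / (1 + δ) * τ i)
      (hout : ∀ i ∉ unsatisfied c v τ P, τ' i = τ i)
      (hP : RoundRobin c v (active v) τ' P') : Reaches c δ v (k + 1) τ' P'

/-- `P` is a possible result of AlgSub: the allocation at hand when `V` is empty. (If no agent has
been kept, the loop is not entered and all goods are allocated arbitrarily; otherwise `P` is the
allocation that the last call of RoundRobin has returned.) -/
def Returns {n m : ℕ} (c δ : ℝ) (v : Fin n → Finset (Fin m) → ℝ) (P : Fin n → Finset (Fin m)) :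
    Prop :=
  ∃ (k : ℕ) (τ : Fin n → ℝ) (P₀ : Fin n → Finset (Fin m)), Reaches c δ v k τ P₀ ∧
    unsatisfied c v τ P₀ = ∅ ∧ IsPartition Finset.univ P ∧ ∀ i, P₀ i ⊆ P i

/-! The machine model: while-programs over finitely many integer arrays and number arrays, with
value queries to the agents. Every evaluated node of an expression costs one step plus the length
of its value; integers always have their binary length, while the length `len` of numbers is a
parameter: constant for a real RAM, the binary length for the bit model. -/

/-- Memory: `nat x k` is the `k`-th cell of the integer array `x`, `num x k` the `k`-th cell of the
number array `x`. A scalar variable is an array of which only cell `0` is used. -/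
structure Store where
  nat : ℕ → ℕ → ℕ
  num : ℕ → ℕ → ℝ

/-- Integer expressions. -/
inductive NExpr where
  | lit (k : ℕ)
  | cell (x : ℕ) (idx : NExpr)
  | add (a b : NExpr)
  | sub (a b : NExpr)
  | mul (a b : NExpr)

def NExpr.eval (σ : Store) : NExpr → ℕ
  | .lit k => k
  | .cell x idx => σ.nat x (idx.eval σ)
  | .add a b => a.eval σ + b.eval σ
  | .sub a b => a.eval σ - b.eval σ
  | .mul a b => a.eval σ * b.eval σ

def NExpr.cost (σ : Store) : NExpr → ℕ
  | .lit k => 1 + Nat.size k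
  | .cell x idx => idx.cost σ + 1 + Nat.size (σ.nat x (idx.eval σ))
  | .add a b => a.cost σ + b.cost σ + 1 + Nat.size (a.eval σ + b.eval σ)
  | .sub a b => a.cost σ + b.cost σ + 1 + Nat.size (a.eval σ - b.eval σ)
  | .mul a b => a.cost σ + b.cost σ + 1 + Nat.size (a.eval σ * b.eval σ)

/-- Number expressions, with rational constants. -/
inductive RExpr where
  | lit (q : ℚ)
  | cell (x : ℕ) (idx : NExpr)
  | add (a b : RExpr)
  | sub (a b : RExpr)
  | mul (a b : RExpr)
  | div (a b : RExpr)

noncomputable def RExpr.eval (σ : Store) : RExpr → ℝ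
  | .lit q => q
  | .cell x idx => σ.num x (idx.eval σ)
  | .add a b => a.eval σ + b.eval σ
  | .sub a b => a.eval σ - b.eval σ
  | .mul a b => a.eval σ * b.eval σ
  | .div a b => a.eval σ / b.eval σ

noncomputable def RExpr.cost (len : ℝ → ℕ) (σ : Store) : RExpr → ℕ
  | .lit q => 1 + len q
  | .cell x idx => idx.cost σ + 1 + len (σ.num x (idx.eval σ))
  | .add a b => a.cost len σ + b.cost len σ + 1 + len (a.eval σ + b.eval σ)
  | .sub a b => a.cost len σ + b.cost len σ + 1 + len (a.eval σ - b.eval σ)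
  | .mul a b => a.cost len σ + b.cost len σ + 1 + len (a.eval σ * b.eval σ)
  | .div a b => a.cost len σ + b.cost len σ + 1 + len (a.eval σ / b.eval σ)

/-- Tests: comparisons of integers or of numbers. -/
inductive Test where
  | natLe (a b : NExpr)
  | numLe (a b : RExpr)

def Test.holds (σ : Store) : Test → Prop
  | .natLe a b => a.eval σ ≤ b.eval σ
  | .numLe a b => a.eval σ ≤ b.eval σ

noncomputable def Test.cost (len : ℝ → ℕ) (σ : Store) : Test → ℕ
  | .natLe a b => a.cost σ + b.cost σ + 1
  | .numLe a b => a.cost len σ + b.cost len σ + 1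

/-- Programs. `query x idx a s` asks agent `a` for her value of the set of those goods `j` for which
cell `j` of the integer array `s` is nonzero, and stores it in cell `idx` of the number array `x`. -/
inductive Prog where
  | skip
  | setNat (x : ℕ) (idx e : NExpr)
  | setNum (x : ℕ) (idx : NExpr) (e : RExpr)
  | query (x : ℕ) (idx a : NExpr) (s : ℕ)
  | seq (p q : Prog)
  | ite (b : Test) (p q : Prog)
  | loop (b : Test) (p : Prog)

def Store.setNat (σ : Store) (x k a : ℕ) : Store :=
  { σ with nat := Function.update σ.nat x (Function.update (σ.nat x) k a) }

noncomputable def Store.setNum (σ : Store) (x k : ℕ) (a : ℝ) : Store :=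
  { σ with num := Function.update σ.num x (Function.update (σ.num x) k a) }

/-- The value oracle: the value of agent `a` (`0` if there is no such agent) for the set of goods
encoded in the integer array `s`. -/
noncomputable def answer {n m : ℕ} (v : Fin n → Finset (Fin m) → ℝ) (σ : Store) (a s : ℕ) : ℝ :=
  if h : a < n then v ⟨a, h⟩ (Finset.univ.filter fun j : Fin m => σ.nat s j ≠ 0) else 0

/-- `Exec len v p σ σ' T`: with oracle `v`, program `p` started in `σ` halts in `σ'` after exactly
`T` steps. -/
inductive Exec (len : ℝ → ℕ) {n m : ℕ} (v : Fin n → Finset (Fin m) → ℝ) :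
    Prog → Store → Store → ℕ → Prop
  | skip (σ : Store) : Exec len v .skip σ σ 1
  | setNat (x : ℕ) (idx e : NExpr) (σ : Store) :
      Exec len v (.setNat x idx e) σ (σ.setNat x (idx.eval σ) (e.eval σ))
        (idx.cost σ + e.cost σ + 1)
  | setNum (x : ℕ) (idx : NExpr) (e : RExpr) (σ : Store) :
      Exec len v (.setNum x idx e) σ (σ.setNum x (idx.eval σ) (e.eval σ))
        (idx.cost σ + e.cost len σ + 1)
  | query (x : ℕ) (idx a : NExpr) (s : ℕ) (σ : Store) :
      Exec len v (.query x idx a s) σ (σ.setNum x (idx.eval σ) (answer v σ (a.eval σ) s))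
        (idx.cost σ + a.cost σ + m + 1 + len (answer v σ (a.eval σ) s))
  | seq (p q : Prog) (σ σ₁ σ₂ : Store) (T₁ T₂ : ℕ) (h₁ : Exec len v p σ σ₁ T₁)
      (h₂ : Exec len v q σ₁ σ₂ T₂) : Exec len v (.seq p q) σ σ₂ (T₁ + T₂)
  | iteTrue (b : Test) (p q : Prog) (σ σ₁ : Store) (T : ℕ) (hb : b.holds σ)
      (h : Exec len v p σ σ₁ T) : Exec len v (.ite b p q) σ σ₁ (b.cost len σ + T)
  | iteFalse (b : Test) (p q : Prog) (σ σ₁ : Store) (T : ℕ) (hb : ¬ b.holds σ)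
      (h : Exec len v q σ σ₁ T) : Exec len v (.ite b p q) σ σ₁ (b.cost len σ + T)
  | loopExit (b : Test) (p : Prog) (σ : Store) (hb : ¬ b.holds σ) :
      Exec len v (.loop b p) σ σ (b.cost len σ)
  | loopStep (b : Test) (p : Prog) (σ σ₁ σ₂ : Store) (T₁ T₂ : ℕ) (hb : b.holds σ)
      (h₁ : Exec len v p σ σ₁ T₁) (h₂ : Exec len v (.loop b p) σ₁ σ₂ T₂) :
      Exec len v (.loop b p) σ σ₂ (b.cost len σ + T₁ + T₂)

/-- The input: the scalars `0` and `1` hold the numbers of agents and of goods, all else is `0`. -/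
def initial (n m : ℕ) : Store where
  nat := fun x k => if x = 0 ∧ k = 0 then n else if x = 1 ∧ k = 0 then m else 0
  num := fun _ _ => 0

/-- Program `p`, given the numbers of agents and goods and the oracle `v`, halts after `T` steps and
outputs the allocation `P`, in the form that cell `j` of array `2` holds the owner of good `j`. -/
def Outputs (len : ℝ → ℕ) {n m : ℕ} (v : Fin n → Finset (Fin m) → ℝ) (p : Prog)
    (P : Fin n → Finset (Fin m)) (T : ℕ) : Prop :=
  ∃ σ, Exec len v p (initial n m) σ T ∧
    ∀ j : Fin m, ∃ i : Fin n, σ.nat 2 j = i ∧ ∀ k : Fin n, j ∈ P k ↔ k = i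

/-- The number of bits of the numerator and the denominator of a rational number. -/
def ratLen (q : ℚ) : ℕ := Nat.size q.num.natAbs + Nat.size q.den

/-- The length of a number in the bit model. It is meant for rational numbers only; a program that
receives rational answers never produces an irrational number. -/
noncomputable def bitLen (x : ℝ) : ℕ := by
  classical exact if h : ∃ q : ℚ, (q : ℝ) = x then ratLen h.choose else 0

/-- AlgSub with factor `c` and step `δ` finds, in polynomial time with oracle access, an allocation
that gives every agent at least `ρ` times her maximin share. -/
def AlgSubFinds (c δ : ℚ) (ρ : ℝ) : Prop :=
  -- every execution ends, after a bounded number of iterations and without getting stuck, with an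
  -- allocation as claimed
  (∀ (n m : ℕ) (v : Fin n → Finset (Fin m) → ℝ), 1 ≤ n → (∀ i, IsValuation (v i)) →
    (∀ k τ P, Reaches c δ v k τ P →
      (k : ℝ) ≤ ∑ i ∈ active v, (1 + Real.logb (1 + δ) (v i Finset.univ / share v i)) ∧
      ((unsatisfied c v τ P).Nonempty → ∃ τ' P', Reaches c δ v (k + 1) τ' P')) ∧
    (∀ P, Returns c δ v P →
      IsPartition Finset.univ P ∧ ∀ i, ρ * share v i ≤ v i (P i))) ∧
  -- one program carries out AlgSub in polynomial time
  ∃ (p : Prog) (C d : ℕ),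
    -- on a real RAM, for real valuations
    (∀ (n m : ℕ) (v : Fin n → Finset (Fin m) → ℝ), 1 ≤ n → (∀ i, IsValuation (v i)) →
      ∃ P T, Outputs (fun _ => 1) v p P T ∧ Returns c δ v P ∧
        T ≤ C * (n + m + ∑ i ∈ active v, ⌈Real.logb 2 (v i Finset.univ / share v i)⌉₊ + 1) ^ d) ∧
    -- in the bit model, for rational valuations with values of at most `L` bits
    (∀ (n m L : ℕ) (v : Fin n → Finset (Fin m) → ℝ), 1 ≤ n → (∀ i, IsValuation (v i)) →
      (∀ i S, ∃ q : ℚ, v i S = q ∧ ratLen q ≤ L) →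
      ∃ P T, Outputs bitLen v p P T ∧ Returns c δ v P ∧ T ≤ C * (n + m + L + 1) ^ d)

end MMS

namespace MMS

/-! The approximation rests on one fact about RoundRobin (`RoundRobin.le_value`): if `c ≤ 1/3` and
`τ i` is at most the maximin share of `i`, then `i` receives at least `c * τ i`. Agents served in
the singleton phase are fine. That phase removes one good per agent served, so among the `n` bundles
of an optimal partition for `i` at least as many are untouched as there are agents left, say `l`.
Suppose `i` ends with `Q` and `v(Q) < cτ`. A good taken in some round has marginal over `Q` at most
what `i` gained in the previous round, or at most `cτ` in the first round. Telescoping, the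
marginals over `Q` of all goods left by the singleton phase sum to at most `l(cτ + v(Q))`. By
submodularity each untouched bundle contributes at least `v(Q ∪ M) - v(Q) ≥ τ - cτ`. Hence `τ - cτ ≤
cτ + v(Q) < 2cτ`, which contradicts `c ≤ 1/3`. The factor 1/10 is therefore not tight for this
argument.

For AlgSub, an agent found unsatisfied must have a threshold at least her share, so after division
by `1 + δ` the threshold is still at least `share / (1 + δ)`. Each iteration lowers the threshold of
some active agent, and hence the number of iterations is at most the sum of `1 + log_{1+δ}(v_i([m])
/ μ_i)` (`Reaches.spec`, `le_one_add_logb`).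

For the running time, a concrete program is verified with Hoare-style rules (`Runs`). If all cells,
loop counts and number lengths are at most `B`, its time is at most a polynomial in `B` read off
from the syntax (`Prog.polyBounded_timeBound`). Positivity of the share is decided by counting goods
of positive value (`maximinShare_pos_iff`). In the bit model the thresholds are `(1 + δ)^(-e) *
v_i([m])` with `e` at most the number of iterations, so their length stays polynomial. The verified
program also proves that RoundRobin never gets stuck (`exists_roundRobin`). -/

@[simp]
theorem Store.nat_setNat_self (σ : Store) (x k a : ℕ) :
    (σ.setNat x k a).nat x = Function.update (σ.nat x) k a := by
  simp [Store.setNat]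

@[simp]
theorem Store.nat_setNat_of_ne (σ : Store) {x y : ℕ} (k a : ℕ) (h : y ≠ x) :
    (σ.setNat x k a).nat y = σ.nat y := by
  simp [Store.setNat, h]

@[simp]
theorem Store.num_setNat (σ : Store) (x k a : ℕ) : (σ.setNat x k a).num = σ.num := rfl

@[simp]
theorem Store.num_setNum_self (σ : Store) (x k : ℕ) (a : ℝ) :
    (σ.setNum x k a).num x = Function.update (σ.num x) k a := by
  simp [Store.setNum]

@[simp]
theorem Store.num_setNum_of_ne (σ : Store) {x y : ℕ} (k : ℕ) (a : ℝ) (h : y ≠ x) :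
    (σ.setNum x k a).num y = σ.num y := by
  simp [Store.setNum, h]

@[simp]
theorem Store.nat_setNum (σ : Store) (x k : ℕ) (a : ℝ) : (σ.setNum x k a).nat = σ.nat := rfl

attribute [simp] NExpr.eval RExpr.eval

/-! ### Syntactic bounds on values and running times -/

/-- A bound on the value of an expression over cells that are at most `B`. -/
def NExpr.valBound (B : ℕ) : NExpr → ℕ
  | .lit k => k
  | .cell _ _ => B
  | .add a b => a.valBound B + b.valBound B
  | .sub a _ => a.valBound B
  | .mul a b => a.valBound B * b.valBound B

/-- A bound on the cost of an expression over cells that are at most `B`. -/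
def NExpr.costBound (B : ℕ) : NExpr → ℕ
  | .lit k => 1 + k
  | .cell _ idx => idx.costBound B + 1 + B
  | .add a b => a.costBound B + b.costBound B + 1 + (a.valBound B + b.valBound B)
  | .sub a b => a.costBound B + b.costBound B + 1 + a.valBound B
  | .mul a b => a.costBound B + b.costBound B + 1 + a.valBound B * b.valBound B

/-- A bound on the cost of an expression all of whose nodes have length at most `B`. -/
def RExpr.costBound (B : ℕ) : RExpr → ℕ
  | .lit _ => 1 + B
  | .cell _ idx => idx.costBound B + 1 + B
  | .add a b => a.costBound B + b.costBound B + 1 + B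
  | .sub a b => a.costBound B + b.costBound B + 1 + B
  | .mul a b => a.costBound B + b.costBound B + 1 + B
  | .div a b => a.costBound B + b.costBound B + 1 + B

/-- All nodes of the expression other than cells have values of length at most `B`. -/
def RExpr.Short (len : ℝ → ℕ) (B : ℕ) (σ : Store) : RExpr → Prop
  | .lit q => len q ≤ B
  | .cell _ _ => True
  | .add a b => a.Short len B σ ∧ b.Short len B σ ∧ len (a.eval σ + b.eval σ) ≤ B
  | .sub a b => a.Short len B σ ∧ b.Short len B σ ∧ len (a.eval σ - b.eval σ) ≤ B
  | .mul a b => a.Short len B σ ∧ b.Short len B σ ∧ len (a.eval σ * b.eval σ) ≤ B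
  | .div a b => a.Short len B σ ∧ b.Short len B σ ∧ len (a.eval σ / b.eval σ) ≤ B

def Test.costBound (B : ℕ) : Test → ℕ
  | .natLe a b => a.costBound B + b.costBound B + 1
  | .numLe a b => a.costBound B + b.costBound B + 1

def Test.Short (len : ℝ → ℕ) (B : ℕ) (σ : Store) : Test → Prop
  | .natLe _ _ => True
  | .numLe a b => a.Short len B σ ∧ b.Short len B σ

/-- A bound on the running time of a program each of whose loops makes at most `B` iterations, over
cells of size at most `B`. -/
def Prog.timeBound (B : ℕ) : Prog → ℕ
  | .skip => 1
  | .setNat _ idx e => idx.costBound B + e.costBound B + 1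
  | .setNum _ idx e => idx.costBound B + e.costBound B + 1
  | .query _ idx a _ => idx.costBound B + a.costBound B + B + 1 + B
  | .seq p q => p.timeBound B + q.timeBound B
  | .ite b p q => b.costBound B + (p.timeBound B + q.timeBound B)
  | .loop b p => (B + 1) * (b.costBound B + p.timeBound B)

/-- The integer arrays that a program may write to. -/
def Prog.setsNat : Prog → ℕ → Bool
  | .skip, _ => false
  | .setNat x _ _, y => x == y
  | .setNum _ _ _, _ => false
  | .query _ _ _ _, _ => false
  | .seq p q, y => p.setsNat y || q.setsNat y
  | .ite _ p q, y => p.setsNat y || q.setsNat y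
  | .loop _ p, y => p.setsNat y

/-- The number arrays that a program may write to. -/
def Prog.setsNum : Prog → ℕ → Bool
  | .skip, _ => false
  | .setNat _ _ _, _ => false
  | .setNum x _ _, y => x == y
  | .query x _ _ _, y => x == y
  | .seq p q, y => p.setsNum y || q.setsNum y
  | .ite _ p q, y => p.setsNum y || q.setsNum y
  | .loop _ p, y => p.setsNum y

/-- `f` is bounded by a polynomial. -/
def PolyBounded (f : ℕ → ℕ) : Prop := ∃ C d, ∀ B, f B ≤ C * (B + 1) ^ d

theorem polyBounded_const (k : ℕ) : PolyBounded fun _ => k := ⟨k, 0, fun B => by simp⟩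

theorem polyBounded_id : PolyBounded fun B => B := ⟨1, 1, fun B => by simp⟩

theorem PolyBounded.add {f g : ℕ → ℕ} (hf : PolyBounded f) (hg : PolyBounded g) :
    PolyBounded fun B => f B + g B := by
  obtain ⟨C, d, h⟩ := hf
  obtain ⟨C', d', h'⟩ := hg
  refine ⟨C + C', d + d', fun B => ?_⟩
  have h1 : (B + 1) ^ d ≤ (B + 1) ^ (d + d') := Nat.pow_le_pow_right (by omega) (by omega)
  have h2 : (B + 1) ^ d' ≤ (B + 1) ^ (d + d') := Nat.pow_le_pow_right (by omega) (by omega)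
  calc f B + g B ≤ C * (B + 1) ^ d + C' * (B + 1) ^ d' := Nat.add_le_add (h B) (h' B)
    _ ≤ C * (B + 1) ^ (d + d') + C' * (B + 1) ^ (d + d') := by gcongr
    _ = _ := by ring

theorem PolyBounded.mul {f g : ℕ → ℕ} (hf : PolyBounded f) (hg : PolyBounded g) :
    PolyBounded fun B => f B * g B := by
  obtain ⟨C, d, h⟩ := hf
  obtain ⟨C', d', h'⟩ := hg
  refine ⟨C * C', d + d', fun B => ?_⟩
  calc f B * g B ≤ (C * (B + 1) ^ d) * (C' * (B + 1) ^ d') := Nat.mul_le_mul (h B) (h' B)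
    _ = _ := by ring

theorem NExpr.polyBounded_valBound (e : NExpr) : PolyBounded fun B => e.valBound B := by
  induction e with
  | lit k => exact polyBounded_const k
  | cell _ _ => exact polyBounded_id
  | add a b ha hb => exact ha.add hb
  | sub a b ha hb => exact ha
  | mul a b ha hb => exact ha.mul hb

theorem NExpr.polyBounded_costBound (e : NExpr) : PolyBounded fun B => e.costBound B := by
  induction e with
  | lit k => exact polyBounded_const _
  | cell _ _ h => exact (h.add (polyBounded_const 1)).add polyBounded_id
  | add a b ha hb =>
    exact ((ha.add hb).add (polyBounded_const 1)).add
      (a.polyBounded_valBound.add b.polyBounded_valBound)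
  | sub a b ha hb => exact ((ha.add hb).add (polyBounded_const 1)).add a.polyBounded_valBound
  | mul a b ha hb =>
    exact ((ha.add hb).add (polyBounded_const 1)).add
      (a.polyBounded_valBound.mul b.polyBounded_valBound)

theorem RExpr.polyBounded_costBound (e : RExpr) : PolyBounded fun B => e.costBound B := by
  induction e with
  | lit q => exact (polyBounded_const 1).add polyBounded_id
  | cell _ i => exact (i.polyBounded_costBound.add (polyBounded_const 1)).add polyBounded_id
  | add a b ha hb => exact ((ha.add hb).add (polyBounded_const 1)).add polyBounded_id
  | sub a b ha hb => exact ((ha.add hb).add (polyBounded_const 1)).add polyBounded_id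
  | mul a b ha hb => exact ((ha.add hb).add (polyBounded_const 1)).add polyBounded_id
  | div a b ha hb => exact ((ha.add hb).add (polyBounded_const 1)).add polyBounded_id

theorem Test.polyBounded_costBound (b : Test) : PolyBounded fun B => b.costBound B := by
  cases b with
  | natLe a b =>
    exact (a.polyBounded_costBound.add b.polyBounded_costBound).add (polyBounded_const 1)
  | numLe a b =>
    exact (a.polyBounded_costBound.add b.polyBounded_costBound).add (polyBounded_const 1)

/-- Each loop contributes a factor `B + 1`, so the degree depends only on the nesting in the fixed
program text. -/
theorem Prog.polyBounded_timeBound (p : Prog) : PolyBounded fun B => p.timeBound B := by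
  induction p with
  | skip => exact polyBounded_const 1
  | setNat _ i e =>
    exact (i.polyBounded_costBound.add e.polyBounded_costBound).add (polyBounded_const 1)
  | setNum _ i e =>
    exact (i.polyBounded_costBound.add e.polyBounded_costBound).add (polyBounded_const 1)
  | query _ i a _ =>
    exact (((i.polyBounded_costBound.add a.polyBounded_costBound).add polyBounded_id).add
      (polyBounded_const 1)).add polyBounded_id
  | seq p q hp hq => exact hp.add hq
  | ite b p q hp hq => exact b.polyBounded_costBound.add (hp.add hq)
  | loop b p hp =>
    exact (polyBounded_id.add (polyBounded_const 1)).mul (b.polyBounded_costBound.add hp)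

/-- All cells of the store are of size at most `B`. -/
structure Store.Bounded (len : ℝ → ℕ) (B : ℕ) (σ : Store) : Prop where
  nat : ∀ x k, σ.nat x k ≤ B
  num : ∀ x k, len (σ.num x k) ≤ B

theorem natSize_le_self (k : ℕ) : Nat.size k ≤ k := Nat.size_le.2 Nat.lt_two_pow_self

/-! ### Costs and cell sizes over bounded stores -/

section Bounds

variable {len : ℝ → ℕ} {B : ℕ} {σ : Store}

theorem NExpr.eval_le_valBound (hσ : σ.Bounded len B) (e : NExpr) : e.eval σ ≤ e.valBound B := by
  induction e with
  | lit k => exact le_rfl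
  | cell _ _ => exact hσ.nat _ _
  | add a b ha hb => exact Nat.add_le_add ha hb
  | sub a b ha hb => exact (Nat.sub_le _ _).trans ha
  | mul a b ha hb => exact Nat.mul_le_mul ha hb

theorem NExpr.cost_le_costBound (hσ : σ.Bounded len B) (e : NExpr) :
    e.cost σ ≤ e.costBound B := by
  induction e with
  | lit k => exact Nat.add_le_add_left (natSize_le_self k) 1
  | cell x i h =>
    exact Nat.add_le_add (Nat.add_le_add_right h 1) ((natSize_le_self _).trans (hσ.nat _ _))
  | add a b ha hb =>
    exact Nat.add_le_add (Nat.add_le_add_right (Nat.add_le_add ha hb) 1)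
      ((natSize_le_self _).trans ((a.add b).eval_le_valBound hσ))
  | sub a b ha hb =>
    exact Nat.add_le_add (Nat.add_le_add_right (Nat.add_le_add ha hb) 1)
      ((natSize_le_self _).trans ((a.sub b).eval_le_valBound hσ))
  | mul a b ha hb =>
    exact Nat.add_le_add (Nat.add_le_add_right (Nat.add_le_add ha hb) 1)
      ((natSize_le_self _).trans ((a.mul b).eval_le_valBound hσ))

theorem RExpr.cost_le_costBound (hσ : σ.Bounded len B) (e : RExpr) (he : e.Short len B σ) :
    e.cost len σ ≤ e.costBound B := by
  induction e with
  | lit q => exact Nat.add_le_add_left he 1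
  | cell x i => exact Nat.add_le_add (Nat.add_le_add_right (i.cost_le_costBound hσ) 1) (hσ.num _ _)
  | add a b ha hb =>
    exact Nat.add_le_add (Nat.add_le_add_right (Nat.add_le_add (ha he.1) (hb he.2.1)) 1) he.2.2
  | sub a b ha hb =>
    exact Nat.add_le_add (Nat.add_le_add_right (Nat.add_le_add (ha he.1) (hb he.2.1)) 1) he.2.2
  | mul a b ha hb =>
    exact Nat.add_le_add (Nat.add_le_add_right (Nat.add_le_add (ha he.1) (hb he.2.1)) 1) he.2.2
  | div a b ha hb =>
    exact Nat.add_le_add (Nat.add_le_add_right (Nat.add_le_add (ha he.1) (hb he.2.1)) 1) he.2.2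

theorem Test.cost_le_costBound (hσ : σ.Bounded len B) (b : Test) (hb : b.Short len B σ) :
    b.cost len σ ≤ b.costBound B := by
  cases b with
  | natLe a b =>
    exact Nat.add_le_add_right
      (Nat.add_le_add (a.cost_le_costBound hσ) (b.cost_le_costBound hσ)) 1
  | numLe a b =>
    exact Nat.add_le_add_right
      (Nat.add_le_add (a.cost_le_costBound hσ hb.1) (b.cost_le_costBound hσ hb.2)) 1

theorem Store.Bounded.setNat (hσ : σ.Bounded len B) {x k a : ℕ} (ha : a ≤ B) :
    (σ.setNat x k a).Bounded len B := by
  refine ⟨fun y l => ?_, hσ.num⟩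
  by_cases h : y = x
  · subst h
    rw [Store.nat_setNat_self, Function.update_apply]
    split_ifs
    exacts [ha, hσ.nat _ _]
  · rw [Store.nat_setNat_of_ne _ _ _ h]
    exact hσ.nat _ _

theorem Store.Bounded.setNum (hσ : σ.Bounded len B) {x k : ℕ} {a : ℝ} (ha : len a ≤ B) :
    (σ.setNum x k a).Bounded len B := by
  refine ⟨hσ.nat, fun y l => ?_⟩
  by_cases h : y = x
  · subst h
    rw [Store.num_setNum_self, Function.update_apply]
    split_ifs
    exacts [ha, hσ.num _ _]
  · rw [Store.num_setNum_of_ne _ _ _ h]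
    exact hσ.num _ _

end Bounds

/-- The stores agree on all arrays that the program does not write to. -/
def Agree (p : Prog) (σ σ' : Store) : Prop :=
  (∀ x, p.setsNat x = false → σ'.nat x = σ.nat x) ∧
    ∀ x, p.setsNum x = false → σ'.num x = σ.num x

theorem Agree.refl (p : Prog) (σ : Store) : Agree p σ σ := ⟨fun _ _ => rfl, fun _ _ => rfl⟩

theorem Agree.trans {p : Prog} {σ₁ σ₂ σ₃ : Store} (h : Agree p σ₁ σ₂) (h' : Agree p σ₂ σ₃) :
    Agree p σ₁ σ₃ :=
  ⟨fun x hx => (h'.1 x hx).trans (h.1 x hx), fun x hx => (h'.2 x hx).trans (h.2 x hx)⟩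

theorem Agree.mono {p q : Prog} {σ σ' : Store} (h : Agree p σ σ')
    (h₁ : ∀ x, q.setsNat x = false → p.setsNat x = false)
    (h₂ : ∀ x, q.setsNum x = false → p.setsNum x = false) : Agree q σ σ' :=
  ⟨fun x hx => h.1 x (h₁ x hx), fun x hx => h.2 x (h₂ x hx)⟩

/-! ### Hoare-style rules with a frame property and time bounds -/

section Runs

variable {n m : ℕ} {len : ℝ → ℕ} {B : ℕ} {v : Fin n → Finset (Fin m) → ℝ}

/-- Frame property. Since the written arrays are computed from the syntax, `rfl` later suffices to
show that a given array has survived a subprogram. -/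
theorem Exec.agree {p : Prog} {σ σ' : Store} {t : ℕ} (h : Exec len v p σ σ' t) :
    Agree p σ σ' := by
  induction h with
  | skip σ => exact Agree.refl _ _
  | setNat x i e σ =>
    refine ⟨fun y hy => Store.nat_setNat_of_ne _ _ _ ?_, fun _ _ => rfl⟩
    rintro rfl
    simp [Prog.setsNat] at hy
  | setNum x i e σ =>
    refine ⟨fun _ _ => rfl, fun y hy => Store.num_setNum_of_ne _ _ _ ?_⟩
    rintro rfl
    simp [Prog.setsNum] at hy
  | query x i a s σ =>
    refine ⟨fun _ _ => rfl, fun y hy => Store.num_setNum_of_ne _ _ _ ?_⟩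
    rintro rfl
    simp [Prog.setsNum] at hy
  | seq p q σ σ₁ σ₂ T₁ T₂ _ _ h₁ h₂ =>
    exact (h₁.mono (q := .seq p q) (fun x hx => (Bool.or_eq_false_iff.1 hx).1)
      fun x hx => (Bool.or_eq_false_iff.1 hx).1).trans
      (h₂.mono (fun x hx => (Bool.or_eq_false_iff.1 hx).2)
      fun x hx => (Bool.or_eq_false_iff.1 hx).2)
  | iteTrue b p q σ σ₁ T _ _ h =>
    exact h.mono (fun x hx => (Bool.or_eq_false_iff.1 hx).1)
      fun x hx => (Bool.or_eq_false_iff.1 hx).1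
  | iteFalse b p q σ σ₁ T _ _ h =>
    exact h.mono (fun x hx => (Bool.or_eq_false_iff.1 hx).2)
      fun x hx => (Bool.or_eq_false_iff.1 hx).2
  | loopExit b p σ _ => exact Agree.refl _ _
  | loopStep b p σ σ₁ σ₂ T₁ T₂ _ _ _ h₁ h₂ =>
    exact (h₁.mono (q := .loop b p) (fun _ h => h) fun _ h => h).trans h₂

/-- Started in `σ`, provided that this store is bounded, the program halts within its time bound in
a bounded store with the property `Q`. -/
def Runs (len : ℝ → ℕ) (B : ℕ) (v : Fin n → Finset (Fin m) → ℝ) (p : Prog) (σ : Store)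
    (Q : Store → Prop) : Prop :=
  σ.Bounded len B → ∃ σ' t, Exec len v p σ σ' t ∧ t ≤ p.timeBound B ∧ σ'.Bounded len B ∧ Q σ'

/-- The consequence rule, in which the frame property comes for free; postconditions thus only need
to mention what has changed. -/
theorem Runs.weaken {p : Prog} {σ : Store} {Q Q' : Store → Prop} (h : Runs len B v p σ Q)
    (hQ : ∀ σ', Agree p σ σ' → Q σ' → Q' σ') : Runs len B v p σ Q' := by
  intro hσ
  obtain ⟨σ', t, h₁, h₂, h₃, h₄⟩ := h hσ
  exact ⟨σ', t, h₁, h₂, h₃, hQ σ' h₁.agree h₄⟩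

theorem runs_skip {σ : Store} {Q : Store → Prop} (hQ : Q σ) : Runs len B v .skip σ Q :=
  fun hσ => ⟨σ, 1, .skip σ, le_rfl, hσ, hQ⟩

theorem runs_setNat {x : ℕ} {i e : NExpr} {σ : Store} {Q : Store → Prop} (he : e.eval σ ≤ B)
    (hQ : Q (σ.setNat x (i.eval σ) (e.eval σ))) : Runs len B v (.setNat x i e) σ Q :=
  fun hσ => ⟨_, _, .setNat x i e σ,
    Nat.add_le_add_right (Nat.add_le_add (i.cost_le_costBound hσ) (e.cost_le_costBound hσ)) 1,
    hσ.setNat he, hQ⟩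

/-- The length bound on the result may assume that the store is bounded, so that copying a cell
requires no separate estimate. -/
theorem runs_setNum {x : ℕ} {i : NExpr} {e : RExpr} {σ : Store} {Q : Store → Prop}
    (hs : e.Short len B σ) (he : σ.Bounded len B → len (e.eval σ) ≤ B)
    (hQ : Q (σ.setNum x (i.eval σ) (e.eval σ))) : Runs len B v (.setNum x i e) σ Q :=
  fun hσ => ⟨_, _, .setNum x i e σ,
    Nat.add_le_add_right (Nat.add_le_add (i.cost_le_costBound hσ) (e.cost_le_costBound hσ hs)) 1,
    hσ.setNum (he hσ), hQ⟩

/-- The lengths of the oracle's answers and their number of bits are at most `B`. -/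
structure OracleBounded (len : ℝ → ℕ) (B : ℕ) (v : Fin n → Finset (Fin m) → ℝ) : Prop where
  value : ∀ i S, len (v i S) ≤ B
  zero : len 0 ≤ B
  agents : n ≤ B
  goods : m ≤ B
  one : 1 ≤ B

theorem runs_query (hv : OracleBounded len B v) {x : ℕ} {i a : NExpr} {s : ℕ} {σ : Store}
    {Q : Store → Prop} (hQ : Q (σ.setNum x (i.eval σ) (answer v σ (a.eval σ) s))) :
    Runs len B v (.query x i a s) σ Q := by
  intro hσ
  have hl : len (answer v σ (a.eval σ) s) ≤ B := by
    unfold answer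
    split_ifs
    exacts [hv.value _ _, hv.zero]
  exact ⟨_, _, .query x i a s σ, Nat.add_le_add (Nat.add_le_add_right (Nat.add_le_add
    (Nat.add_le_add (i.cost_le_costBound hσ) (a.cost_le_costBound hσ)) hv.goods) 1) hl,
    hσ.setNum hl, hQ⟩

theorem runs_seq {p q : Prog} {σ : Store} {Q : Store → Prop}
    (h : Runs len B v p σ fun σ' => Runs len B v q σ' Q) : Runs len B v (.seq p q) σ Q := by
  intro hσ
  obtain ⟨σ₁, t₁, h₁, ht₁, hb₁, h⟩ := h hσ
  obtain ⟨σ₂, t₂, h₂, ht₂, hb₂, h⟩ := h hb₁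
  exact ⟨σ₂, _, .seq p q σ σ₁ σ₂ t₁ t₂ h₁ h₂, Nat.add_le_add ht₁ ht₂, hb₂, h⟩

theorem runs_ite {b : Test} {p q : Prog} {σ : Store} {Q : Store → Prop} (hs : b.Short len B σ)
    (h₁ : b.holds σ → Runs len B v p σ Q) (h₂ : ¬ b.holds σ → Runs len B v q σ Q) :
    Runs len B v (.ite b p q) σ Q := by
  intro hσ
  by_cases hb : b.holds σ
  · obtain ⟨σ', t, h, ht, hb', hq⟩ := h₁ hb hσ
    exact ⟨σ', _, .iteTrue b p q σ σ' t hb h, Nat.add_le_add (b.cost_le_costBound hσ hs)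
      (ht.trans (Nat.le_add_right _ _)), hb', hq⟩
  · obtain ⟨σ', t, h, ht, hb', hq⟩ := h₂ hb hσ
    exact ⟨σ', _, .iteFalse b p q σ σ' t hb h, Nat.add_le_add (b.cost_le_costBound hσ hs)
      (ht.trans (Nat.le_add_left _ _)), hb', hq⟩

/-- The invariant carries the iteration number `k`. That a true test forces `k < B` gives both
termination and the time bound. -/
theorem runs_loop {b : Test} {p : Prog} {σ₀ : Store} {Q : Store → Prop} (I : ℕ → Store → Prop)
    (h₀ : I 0 σ₀) (hs : ∀ k σ, I k σ → b.Short len B σ)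
    (hlt : ∀ k σ, σ.Bounded len B → I k σ → b.holds σ → k < B)
    (hstep : ∀ k σ, Agree (.loop b p) σ₀ σ → I k σ → b.holds σ →
      Runs len B v p σ fun σ' => I (k + 1) σ')
    (hQ : ∀ k σ, Agree (.loop b p) σ₀ σ → I k σ → ¬ b.holds σ → Q σ) :
    Runs len B v (.loop b p) σ₀ Q := by
  intro hσ₀
  -- Induction on the number `d` of iterations still allowed; the extra `1` in `d + 1` pays for the
  -- final failing test.
  suffices H : ∀ d k σ, k + d = B → σ.Bounded len B → Agree (.loop b p) σ₀ σ → I k σ →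
      ∃ σ' t, Exec len v (.loop b p) σ σ' t ∧ t ≤ (d + 1) * (b.costBound B + p.timeBound B) ∧
        σ'.Bounded len B ∧ Q σ' from H B 0 σ₀ (Nat.zero_add B) hσ₀ (Agree.refl _ _) h₀
  intro d
  induction d with
  | zero =>
    intro k σ hk hσ ha hI
    have hb : ¬ b.holds σ := fun hb => by have := hlt k σ hσ hI hb; omega
    refine ⟨σ, _, .loopExit b p σ hb, ?_, hσ, hQ k σ ha hI hb⟩
    have := b.cost_le_costBound hσ (hs k σ hI)
    omega
  | succ d ih =>
    intro k σ hk hσ ha hI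
    have hc := b.cost_le_costBound hσ (hs k σ hI)
    by_cases hb : b.holds σ
    · obtain ⟨σ₁, t₁, h₁, ht₁, hb₁, hI₁⟩ := hstep k σ ha hI hb hσ
      obtain ⟨σ₂, t₂, h₂, ht₂, hb₂, hQ₂⟩ := ih (k + 1) σ₁ (by omega) hb₁
        (ha.trans (h₁.agree.mono (fun _ h => h) fun _ h => h)) hI₁
      refine ⟨σ₂, _, .loopStep b p σ σ₁ σ₂ t₁ t₂ hb h₁ h₂, ?_, hb₂, hQ₂⟩
      rw [Nat.add_mul, Nat.one_mul]
      omega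
    · refine ⟨σ, _, .loopExit b p σ hb, ?_, hσ, hQ k σ ha hI hb⟩
      rw [Nat.add_mul, Nat.one_mul]
      omega

/-- The scalar integer variable `x`. -/
abbrev scalar (x : ℕ) : NExpr := .cell x (.lit 0)

/-- The cell of the integer array `x` whose index is the scalar variable `i`. -/
abbrev entry (x i : ℕ) : NExpr := .cell x (.cell i (.lit 0))

/-- `for x := 0 to y - 1 do p`, for scalar variables `x` and `y`. -/
def forLoop (x y : ℕ) (p : Prog) : Prog :=
  .seq (.setNat x (.lit 0) (.lit 0))
    (.loop (.natLe (.add (scalar x) (.lit 1)) (scalar y))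
      (.seq p (.setNat x (.lit 0) (.add (scalar x) (.lit 1)))))

/-- No bound on `N` has to be supplied: the limit sits in a cell of a bounded store, so a true test
puts the counter below `B`. -/
theorem runs_forLoop {x y N : ℕ} {p : Prog} {σ₀ : Store} {Q : Store → Prop}
    (hx : p.setsNat x = false) (hy : p.setsNat y = false) (hxy : y ≠ x) (hN : σ₀.nat y 0 = N)
    (I : ℕ → Store → Prop) (h₀ : I 0 (σ₀.setNat x 0 0))
    (hstep : ∀ k σ, k < N → Agree (forLoop x y p) σ₀ σ → σ.nat x 0 = k → I k σ →
      Runs len B v p σ fun σ' => I (k + 1) (σ'.setNat x 0 (k + 1)))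
    (hQ : ∀ σ, Agree (forLoop x y p) σ₀ σ → I N σ → Q σ) :
    Runs len B v (forLoop x y p) σ₀ Q := by
  refine runs_seq (runs_setNat (Nat.zero_le _) ?_)
  have hag : ∀ z, (forLoop x y p).setsNat z = false → x ≠ z ∧ p.setsNat z = false := by
    intro z hz
    simp only [forLoop, Prog.setsNat, Bool.or_eq_false_iff, beq_eq_false_iff_ne] at hz
    exact ⟨hz.1, hz.2.1⟩
  have hag' : ∀ z, (forLoop x y p).setsNum z = false → p.setsNum z = false := by
    intro z hz
    simpa only [forLoop, Prog.setsNum, Bool.or_eq_false_iff, and_true, true_and] using hz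
  have hset : ∀ σ k, Agree (forLoop x y p) σ (σ.setNat x 0 k) := fun σ k =>
    ⟨fun z hz => Store.nat_setNat_of_ne _ _ _ (hag z hz).1.symm, fun _ _ => rfl⟩
  have hfix : ∀ q : Prog, q.setsNat y = false → ∀ {σ σ'}, Agree q σ σ' → σ'.nat y 0 = σ.nat y 0 :=
    fun q hq σ σ' h => by rw [h.1 y hq]
  refine runs_loop (fun k σ => k ≤ N ∧ σ.nat x 0 = k ∧ σ.nat y 0 = N ∧
    Agree (forLoop x y p) σ₀ σ ∧ I k σ) ⟨Nat.zero_le _, ?_, ?_, hset _ _, h₀⟩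
    (fun _ _ _ => trivial) ?_ ?_ ?_
  · simp [Store.nat_setNat_self, NExpr.eval]
  · rw [Store.nat_setNat_of_ne _ _ _ hxy, hN]
  · rintro k σ hσ ⟨-, hk, hy', -, -⟩ hb
    have hb' : σ.nat x 0 + 1 ≤ σ.nat y 0 := hb
    have := hσ.nat y 0
    omega
  · rintro k σ - ⟨-, hk, hy', ha, hI⟩ hb hσ
    have hb' : σ.nat x 0 + 1 ≤ σ.nat y 0 := hb
    have hyB := hσ.nat y 0
    revert hσ
    refine runs_seq ((hstep k σ (by omega) ha hk hI).weaken fun σ' ha' hI' => ?_)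
    have hk' : σ'.nat x 0 = k := by rw [ha'.1 x hx, hk]
    refine runs_setNat ?_ ?_
    · simp only [NExpr.eval, hk']; omega
    · simp only [NExpr.eval, hk']
      refine ⟨by omega, ?_, ?_, (ha.trans ?_).trans (hset _ _), hI'⟩
      · simp [Store.nat_setNat_self]
      · rw [Store.nat_setNat_of_ne _ _ _ hxy, ha'.1 y hy, hy']
      · exact ha'.mono (fun z hz => (hag z hz).2) hag'
  · rintro k σ - ⟨hkN, hk, hy', ha, hI⟩ hb
    have hb' : ¬ σ.nat x 0 + 1 ≤ σ.nat y 0 := hb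
    have : k = N := by omega
    subst this
    exact hQ σ ha hI

/-- `for i := 0 to y - 1 do x[i] := e`, with the integer variable `12` as the counter `i`. -/
def mapArray (y x : ℕ) (e : NExpr) : Prog := forLoop 12 y (.setNat x (scalar 12) e)

/-- While cell `k` is computed, it still has its original value, so `e` may transform the array in
place. -/
theorem runs_mapArray {y x N : ℕ} {e : NExpr} {σ₀ : Store} {Q : Store → Prop}
    (hx : x ≠ 12) (hy : y ≠ 12) (hxy : x ≠ y) (hN : σ₀.nat y 0 = N) (f : ℕ → ℕ)
    (he : ∀ k σ, k < N → Agree (mapArray y x e) σ₀ σ → σ.nat 12 0 = k →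
      σ.nat x k = σ₀.nat x k → e.eval σ = f k ∧ f k ≤ B)
    (hQ : ∀ σ, Agree (mapArray y x e) σ₀ σ → (∀ k < N, σ.nat x k = f k) → Q σ) :
    Runs len B v (mapArray y x e) σ₀ Q := by
  refine runs_forLoop (by simpa [Prog.setsNat] using hx) (by simpa [Prog.setsNat] using hxy) hy hN
    (fun k σ => (∀ l < k, σ.nat x l = f l) ∧ ∀ l, k ≤ l → σ.nat x l = σ₀.nat x l) ?_ ?_ ?_
  · simp [Store.nat_setNat_of_ne _ _ _ hx]
  · rintro k σ hk ha hc ⟨h₁, h₂⟩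
    obtain ⟨h₃, h₄⟩ := he k σ hk ha hc (h₂ k le_rfl)
    refine runs_setNat (h₃.trans_le h₄) ?_
    simp only [NExpr.eval, hc, h₃, Store.nat_setNat_of_ne _ _ _ hx, Store.nat_setNat_self]
    refine ⟨fun l hl => ?_, fun l hl => ?_⟩
    · rw [Function.update_apply]
      split_ifs with h
      · rw [h]
      · exact h₁ l (by omega)
    · rw [Function.update_of_ne (by omega)]
      exact h₂ l (by omega)
  · rintro σ ha ⟨h₁, -⟩
    exact hQ σ ha h₁

end Runs

/-! ### Submodular valuations and maximin shares -/

section Valuation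

variable {m : ℕ} {v : Finset (Fin m) → ℝ}

theorem IsValuation.marginal_anti (hv : IsValuation v) {A B : Finset (Fin m)} (h : A ⊆ B)
    (g : Fin m) : v (insert g B) - v B ≤ v (insert g A) - v A := by
  by_cases hg : g ∈ B
  · rw [Finset.insert_eq_of_mem hg, sub_self]
    exact sub_nonneg.2 (hv.mono _ _ (Finset.subset_insert _ _))
  · exact hv.submod A B g h hg

theorem IsValuation.marginal_nonneg (hv : IsValuation v) (A : Finset (Fin m)) (g : Fin m) :
    0 ≤ v (insert g A) - v A :=
  sub_nonneg.2 (hv.mono _ _ (Finset.subset_insert _ _))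

/-- Add the goods of `M` one at a time: each marginal over a larger set is at most the marginal over
`A`. -/
theorem IsValuation.union_le (hv : IsValuation v) (A M : Finset (Fin m)) :
    v (A ∪ M) ≤ v A + ∑ j ∈ M, (v (insert j A) - v A) := by
  induction M using Finset.induction_on with
  | empty => simp
  | insert g M hg ih =>
    rw [Finset.sum_insert hg, Finset.union_insert]
    have := hv.marginal_anti (Finset.subset_union_left (s₁ := A) (s₂ := M)) g
    linarith

theorem IsValuation.exists_singleton_pos (hv : IsValuation v) {M : Finset (Fin m)}
    (h : 0 < v M) : ∃ j ∈ M, 0 < v {j} := by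
  by_contra! hc
  have h1 := hv.union_le ∅ M
  have h2 : ∑ j ∈ M, (v (insert j ∅) - v ∅) ≤ 0 := Finset.sum_nonpos fun j hj => by
    have := hc j hj
    rw [hv.empty, insert_empty_eq]
    linarith
  rw [Finset.empty_union] at h1
  linarith [hv.empty]

end Valuation

section Share

variable {n m : ℕ} {v : Finset (Fin m) → ℝ}

theorem isPartition_filter (o : Fin m → Fin n) :
    IsPartition Finset.univ fun k => Finset.univ.filter fun j => o j = k := by
  refine ⟨fun i k hik => Finset.disjoint_left.2 fun j hi hk => hik ?_, ?_⟩
  · rw [← (Finset.mem_filter.1 hi).2, (Finset.mem_filter.1 hk).2]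
  · ext j
    simp

/-- Finiteness makes the `sSup` in the maximin share an attained maximum. -/
theorem finite_maximinShare_set (n : ℕ) (v : Finset (Fin m) → ℝ) :
    {x | ∃ A : Fin n → Finset (Fin m), IsPartition Finset.univ A ∧ x = ⨅ k, v (A k)}.Finite := by
  refine (Set.finite_range fun A : Fin n → Finset (Fin m) => ⨅ k, v (A k)).subset ?_
  rintro x ⟨A, -, rfl⟩
  exact ⟨A, rfl⟩

theorem exists_partition_maximinShare_le (hn : 1 ≤ n) (v : Finset (Fin m) → ℝ) :
    ∃ A : Fin n → Finset (Fin m), IsPartition Finset.univ A ∧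
      ∀ k, maximinShare n v Finset.univ ≤ v (A k) := by
  have hne : {x | ∃ A : Fin n → Finset (Fin m), IsPartition Finset.univ A ∧
      x = ⨅ k, v (A k)}.Nonempty := ⟨_, _, isPartition_filter fun _ => ⟨0, hn⟩, rfl⟩
  obtain ⟨A, hA, h⟩ := hne.csSup_mem (finite_maximinShare_set n v)
  exact ⟨A, hA, fun k => h.trans_le (ciInf_le (Set.finite_range _).bddBelow k)⟩

theorem exists_le_maximinShare (hn : 1 ≤ n) {A : Fin n → Finset (Fin m)}
    (hA : IsPartition Finset.univ A) : ∃ k, v (A k) ≤ maximinShare n v Finset.univ := by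
  have : Nonempty (Fin n) := ⟨⟨0, hn⟩⟩
  obtain ⟨k, hk⟩ := exists_eq_ciInf_of_finite (f := fun k => v (A k))
  exact ⟨k, hk.trans_le (le_csSup (finite_maximinShare_set n v).bddAbove ⟨A, hA, rfl⟩)⟩

theorem maximinShare_le_univ (hn : 1 ≤ n) (hv : IsValuation v) :
    maximinShare n v Finset.univ ≤ v Finset.univ := by
  obtain ⟨A, -, h⟩ := exists_partition_maximinShare_le hn v
  exact (h ⟨0, hn⟩).trans (hv.mono _ _ (Finset.subset_univ _))

/-- The maximin share is one of the values of the valuation. -/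
theorem exists_eq_maximinShare (hn : 1 ≤ n) (v : Finset (Fin m) → ℝ) :
    ∃ S, maximinShare n v Finset.univ = v S := by
  have : Nonempty (Fin n) := ⟨⟨0, hn⟩⟩
  have hne : {x | ∃ A : Fin n → Finset (Fin m), IsPartition Finset.univ A ∧
      x = ⨅ k, v (A k)}.Nonempty := ⟨_, _, isPartition_filter fun _ => ⟨0, hn⟩, rfl⟩
  obtain ⟨A, -, h⟩ := hne.csSup_mem (finite_maximinShare_set n v)
  obtain ⟨k, hk⟩ := exists_eq_ciInf_of_finite (f := fun k => v (A k))
  exact ⟨A k, h.trans hk.symm⟩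

/-- The maximin share is positive iff at least `n` goods have a positive value. -/
theorem maximinShare_pos_iff (hn : 1 ≤ n) (hv : IsValuation v) :
    0 < maximinShare n v Finset.univ ↔ n ≤ (Finset.univ.filter fun j => 0 < v {j}).card := by
  have : Nonempty (Fin n) := ⟨⟨0, hn⟩⟩
  constructor
  · intro h
    obtain ⟨A, hA, hle⟩ := exists_partition_maximinShare_le hn v
    choose f hf hpos using fun k => hv.exists_singleton_pos (h.trans_le (hle k))
    have hinj : Function.Injective f := by
      intro i k hik
      by_contra hne
      exact Finset.disjoint_left.1 (hA.1 i k hne) (hf i) (hik ▸ hf k)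
    calc n = (Finset.univ.image f).card := by
          rw [Finset.card_image_of_injective _ hinj, Finset.card_univ, Fintype.card_fin]
      _ ≤ _ := Finset.card_le_card fun j hj => by
          obtain ⟨k, -, rfl⟩ := Finset.mem_image.1 hj
          exact Finset.mem_filter.2 ⟨Finset.mem_univ _, hpos k⟩
  · intro h
    obtain ⟨f⟩ : Nonempty (Fin n ↪ (Finset.univ.filter fun j => 0 < v {j} : Finset (Fin m))) :=
      Function.Embedding.nonempty_of_card_le (by rwa [Fintype.card_fin, Fintype.card_coe])
    let g : Fin n → Fin m := fun k => (f k : Fin m)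
    have hg : Function.Injective g := Subtype.val_injective.comp f.injective
    -- Agent `k` owns the good `g k`; goods outside the range of `g` land in arbitrary bundles,
    -- which is harmless by monotonicity.
    obtain ⟨k, hk⟩ := exists_le_maximinShare (v := v) hn
      (isPartition_filter (Function.invFun g))
    refine lt_of_lt_of_le (Finset.mem_filter.1 (f k).2).2 (le_trans (hv.mono _ _ ?_) hk)
    intro j hj
    rw [Finset.mem_singleton.1 hj]
    exact Finset.mem_filter.2 ⟨Finset.mem_univ _, Function.leftInverse_invFun hg k⟩

end Share

/-! ### The guarantee of RoundRobin -/

section RoundRobin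

variable {n m : ℕ} {c : ℝ} {v : Fin n → Finset (Fin m) → ℝ} {τ : Fin n → ℝ}

/-- Each step removes exactly one agent and one good. This conservation law later bounds how many
bundles of an optimal partition are damaged. -/
theorem SingletonPhase.spec {s t : RRState n m} (h : SingletonPhase c v τ s t) :
    t.agents ⊆ s.agents ∧ t.agents.card + s.goods.card = s.agents.card + t.goods.card ∧
      (∀ i, i ∈ t.agents ∨ i ∉ s.agents → t.bundle i = s.bundle i) ∧
      (∀ i ∈ s.agents, i ∉ t.agents → c * τ i ≤ v i (t.bundle i)) ∧
      ∀ i ∈ t.agents, ∀ j ∈ t.goods, v i {j} < c * τ i := by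
  induction h with
  | finish s h => exact ⟨subset_rfl, rfl, fun _ _ => rfl, fun i h₁ h₂ => absurd h₁ h₂, h⟩
  | step s t i j hi hj h ht ih =>
    obtain ⟨h₁, h₂, h₃, h₄, h₅⟩ := ih
    have hit : i ∉ t.agents := fun h => Finset.notMem_erase i _ (h₁ h)
    refine ⟨h₁.trans (Finset.erase_subset _ _), ?_, fun k hk => ?_, fun k hk hkt => ?_, h₅⟩
    · have ha := Finset.card_erase_add_one hi
      have hb := Finset.card_erase_add_one hj
      simp only at h₂
      omega
    · have hki : k ≠ i := by
        rintro rfl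
        exact hk.elim hit fun h => h hi
      rw [h₃ k (hk.imp_right fun h h' => h (Finset.mem_of_mem_erase h'))]
      exact Function.update_of_ne hki _ _
    · by_cases hki : k = i
      · subst hki
        rw [h₃ k (Or.inr (Finset.notMem_erase k _))]
        simpa using h
      · exact h₄ k (Finset.mem_erase.2 ⟨hki, hk⟩) hkt

theorem Round.spec {l : List (Fin n)} {s t : RRState n m} (h : Round v l s t) :
    t.goods ⊆ s.goods ∧ s.goods.card ≤ t.goods.card + l.length ∧
      (∀ i, s.bundle i ⊆ t.bundle i) ∧ ∀ i ∉ l, t.bundle i = s.bundle i := by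
  induction h with
  | nil s => exact ⟨subset_rfl, le_rfl, fun _ => subset_rfl, fun _ _ => rfl⟩
  | exhausted l s h =>
    exact ⟨subset_rfl, Nat.le_add_right _ _, fun _ => subset_rfl, fun _ _ => rfl⟩
  | pick i l s t g hg hmax ht ih =>
    obtain ⟨h₁, h₂, h₃, h₄⟩ := ih
    refine ⟨h₁.trans (Finset.erase_subset _ _), ?_, fun k => ?_, fun k hk => ?_⟩
    · have := Finset.card_erase_add_one hg
      simp only at h₂
      rw [List.length_cons]
      omega
    · refine subset_trans ?_ (h₃ k)
      by_cases hki : k = i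
      · subst hki
        simp
      · simp [hki]
    · rw [List.mem_cons, not_or] at hk
      rw [h₄ k hk.2]
      exact Function.update_of_ne hk.1 _ _

/-- A good left after the round was available when `i` picked, so its marginal was at most the gain
of `i`; submodularity keeps this true after the pick. As `l` has no duplicates, that gain is the
whole change in the round. -/
theorem Round.marginal_le {i : Fin n} (hv : IsValuation (v i)) {l : List (Fin n)}
    {s t : RRState n m} (h : Round v l s t) (hl : l.Nodup) (hi : i ∈ l) :
    ∀ j ∈ t.goods, v i (insert j (t.bundle i)) - v i (t.bundle i) ≤
      v i (t.bundle i) - v i (s.bundle i) := by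
  induction h with
  | nil s => simp at hi
  | exhausted l s h => simp [h]
  | pick k l s t g hg hmax ht ih =>
    rw [List.nodup_cons] at hl
    by_cases hki : k = i
    · subst hki
      intro j hj
      have hb : t.bundle k = insert g (s.bundle k) := by
        rw [ht.spec.2.2.2 k hl.1]
        simp
      have h₁ := hmax j (Finset.mem_of_mem_erase (ht.spec.1 hj))
      have h₂ := hv.marginal_anti (Finset.subset_insert g (s.bundle k)) j
      rw [hb]
      linarith
    · have := ih hl.2 ((List.mem_cons.1 hi).resolve_left fun h => hki h.symm)
      simpa [Function.update_of_ne (Ne.symm hki)] using this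

theorem GreedyPhase.bundle_subset {l : List (Fin n)} {s u : RRState n m}
    (h : GreedyPhase v l s u) (i : Fin n) : s.bundle i ⊆ u.bundle i := by
  induction h with
  | finish s h => exact subset_rfl
  | round s t u hs hl hr hu ih => exact (hr.spec.2.2.1 i).trans ih

/-- Charging argument: at most `l.length` goods disappear in a round, each with marginal at most
`D`, where `D` bounds the marginals at its start. For the next round `D` is replaced by the gain of
`i` in this one, so the bounds telescope to the initial `D` plus the total gain. -/
theorem GreedyPhase.sum_marginal_le {i : Fin n} (hv : IsValuation (v i)) {l : List (Fin n)}
    {s u : RRState n m} (h : GreedyPhase v l s u) (hl : l.Nodup) (hi : i ∈ l) (D : ℝ) (hD₀ : 0 ≤ D)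
    (hD : ∀ j ∈ s.goods, v i (insert j (s.bundle i)) - v i (s.bundle i) ≤ D) :
    ∑ j ∈ s.goods, (v i (insert j (u.bundle i)) - v i (u.bundle i)) ≤
      l.length * (D + (v i (u.bundle i) - v i (s.bundle i))) := by
  induction h generalizing D with
  | finish s h =>
    have hs : s.goods = ∅ := h.resolve_right fun h => by simp [h] at hi
    rw [hs, Finset.sum_empty, sub_self, add_zero]
    positivity
  | round s t u hs hne hr hu ih =>
    obtain ⟨h₁, h₂, h₃, -⟩ := hr.spec
    have hd : 0 ≤ v i (t.bundle i) - v i (s.bundle i) := sub_nonneg.2 (hv.mono _ _ (h₃ i))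
    have h₄ := ih _ hd (hr.marginal_le hv hl hi)
    have hcard : ((s.goods \ t.goods).card : ℝ) ≤ l.length := by
      have := Finset.card_sdiff_add_card_eq_card h₁
      exact_mod_cast (by omega : (s.goods \ t.goods).card ≤ l.length)
    have h₅ : ∑ j ∈ s.goods \ t.goods, (v i (insert j (u.bundle i)) - v i (u.bundle i)) ≤
        (s.goods \ t.goods).card * D := by
      rw [← nsmul_eq_mul]
      refine Finset.sum_le_card_nsmul _ _ _ fun j hj => ?_
      exact (hv.marginal_anti ((h₃ i).trans (hu.bundle_subset i)) j).trans
        (hD j (Finset.sdiff_subset hj))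
    have h₆ := mul_le_mul_of_nonneg_right hcard hD₀
    rw [← Finset.sum_sdiff h₁]
    nlinarith

/-- RoundRobin gives an agent at least a `c` fraction of any threshold that does not exceed her
maximin share. -/
theorem RoundRobin.le_value (hn : 1 ≤ n) (hc₀ : 0 ≤ c) (hc : c ≤ 1 / 3) {A₀ : Finset (Fin n)}
    {P : Fin n → Finset (Fin m)} (h : RoundRobin c v A₀ τ P) {i : Fin n} (hv : IsValuation (v i))
    (hi : i ∈ A₀) (hτ : τ i ≤ share v i) : c * τ i ≤ v i (P i) := by
  obtain ⟨s, t, l, hs, hl, hls, ht, -, hP⟩ := h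
  obtain ⟨h₁, h₂, h₃, h₄, h₅⟩ := hs.spec
  refine le_trans ?_ (hv.mono _ _ (hP i))
  by_cases his : i ∈ s.agents
  swap
  · exact (h₄ i hi his).trans (hv.mono _ _ (ht.bundle_subset i))
  rcases le_or_gt (τ i) 0 with hτ₀ | hτ₀
  · exact (mul_nonpos_of_nonneg_of_nonpos hc₀ hτ₀).trans (hv.nonneg _)
  by_contra! hlt
  have hb : s.bundle i = ∅ := h₃ i (Or.inl his)
  have hil : i ∈ l := by rwa [← List.mem_toFinset, hls]
  have hlen : l.length = s.agents.card := by rw [← hls, List.toFinset_card_of_nodup hl]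
  have hsum := ht.sum_marginal_le hv hl hil (c * τ i) (by positivity) fun j hj => by
    rw [hb, hv.empty, sub_zero, insert_empty_eq]
    exact (h₅ i his j hj).le
  rw [hb, hv.empty, sub_zero] at hsum
  set Q := t.bundle i
  obtain ⟨M, hM, hMle⟩ := exists_partition_maximinShare_le hn (v i)
  -- the bundles of the optimal partition that the first phase has left intact
  set I : Finset (Fin n) := Finset.univ.filter fun k => M k ⊆ s.goods
  -- Map each damaged bundle to a missing good in it. Bundles are disjoint, so there are at most as
  -- many damaged bundles as missing goods, which is the number of agents served; with at most `n`
  -- agents at the start, at least as many bundles as remaining agents are intact.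
  have hI : l.length ≤ I.card := by
    have hex : ∀ k ∈ Iᶜ, ∃ j, j ∈ M k ∧ j ∉ s.goods := fun k hk => by
      simpa [I, Finset.not_subset] using hk
    have hcard : Iᶜ.card ≤ s.goodsᶜ.card := by
      refine Finset.card_le_card_of_forall_subsingleton (fun k j => j ∈ M k) (fun k hk => ?_) ?_
      · obtain ⟨j, hj, hjs⟩ := hex k hk
        exact ⟨j, Finset.mem_compl.2 hjs, hj⟩
      · intro j _ k hk k' hk'
        by_contra hne
        exact Finset.disjoint_left.1 (hM.1 k k' hne) hk.2 hk'.2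
    have hA := Finset.card_le_univ A₀
    have hIu := Finset.card_add_card_compl I
    have hgu := Finset.card_add_card_compl s.goods
    simp only [Fintype.card_fin, Finset.card_univ] at *
    omega
  have hIsum : ∑ k ∈ I, ∑ j ∈ M k, (v i (insert j Q) - v i Q) ≤
      ∑ j ∈ s.goods, (v i (insert j Q) - v i Q) := by
    rw [← Finset.sum_biUnion fun k _ k' _ hne => hM.1 k k' hne]
    refine Finset.sum_le_sum_of_subset_of_nonneg
      (Finset.biUnion_subset.2 fun k hk => (Finset.mem_filter.1 hk).2)
      fun j _ _ => hv.marginal_nonneg _ _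
  -- Each intact bundle has `v (Q ∪ M k) ≥ τ i` while `v Q < c * τ i`.
  have hge : (I.card : ℝ) * (τ i - c * τ i) ≤ ∑ k ∈ I, ∑ j ∈ M k, (v i (insert j Q) - v i Q) := by
    rw [← nsmul_eq_mul]
    refine Finset.card_nsmul_le_sum _ _ _ fun k _ => ?_
    have h1 := hv.union_le Q (M k)
    have h2 := hv.mono _ _ (Finset.subset_union_right (s₁ := Q) (s₂ := M k))
    have h3 := hMle k
    have h4 : share v i = maximinShare n (v i) Finset.univ := rfl
    linarith
  have hI' : (l.length : ℝ) ≤ I.card := by exact_mod_cast hI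
  have hpos : (1 : ℝ) ≤ l.length := by
    exact_mod_cast List.length_pos_of_mem hil
  have hcτ : c * τ i ≤ 1 / 3 * τ i := mul_le_mul_of_nonneg_right hc hτ₀.le
  have h6 := mul_le_mul_of_nonneg_right hI' (by linarith : 0 ≤ τ i - c * τ i)
  have h7 : (l.length : ℝ) * (τ i - c * τ i) ≤ l.length * (c * τ i + v i Q) := by linarith
  -- After division by `l.length`: `τ - cτ ≤ cτ + v(Q) < 2cτ`, impossible for `c ≤ 1/3`.
  have h8 := le_of_mul_le_mul_left h7 (by linarith)
  linarith

end RoundRobin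

/-! ### The loop of AlgSub -/

section AlgSub

variable {n m : ℕ} {c δ : ℝ} {v : Fin n → Finset (Fin m) → ℝ}

theorem mem_active {i : Fin n} : i ∈ active v ↔ 0 < share v i := by
  simp [active]

theorem mem_unsatisfied {τ : Fin n → ℝ} {P : Fin n → Finset (Fin m)} {i : Fin n} :
    i ∈ unsatisfied c v τ P ↔ i ∈ active v ∧ v i (P i) < c * τ i := by
  simp [unsatisfied]

/-- The loop invariant. The exponent `e i` counts how often the threshold of `i` was divided: `e i ≤
k` controls bit lengths, and `k ≤ ∑ e i` holds because the unsatisfied set is a nonempty set of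
active agents in every iteration. -/
theorem Reaches.spec (hn : 1 ≤ n) (hv : ∀ i, IsValuation (v i)) (hc₀ : 0 ≤ c) (hc : c ≤ 1 / 3)
    (hδ : 0 < δ) {k : ℕ} {τ : Fin n → ℝ} {P : Fin n → Finset (Fin m)}
    (h : Reaches c δ v k τ P) :
    (∀ i ∈ unsatisfied c v τ P, share v i ≤ τ i) ∧
      (∀ i ∈ active v, share v i ≤ (1 + δ) * τ i) ∧
      ∃ e : Fin n → ℕ, (∀ i, τ i = (1 / (1 + δ)) ^ e i * v i Finset.univ) ∧
        (∀ i, e i ≤ k) ∧ k ≤ ∑ i ∈ active v, e i := by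
  have hpos : 0 < 1 + δ := by linarith
  induction h with
  | start =>
    have h₁ : ∀ i, share v i ≤ v i Finset.univ := fun i => maximinShare_le_univ hn (hv i)
    refine ⟨fun i _ => h₁ i, fun i _ => ?_, fun _ => 0, by simp, by simp, by simp⟩
    have := (hv i).nonneg Finset.univ
    nlinarith [h₁ i]
  | iterate k τ τ' P P' h hV hin hout hP ih =>
    obtain ⟨h₁, h₂, e, he, hek, hke⟩ := ih
    refine ⟨fun i hi => ?_, fun i hi => ?_,
      fun i => if i ∈ unsatisfied c v τ P then e i + 1 else e i, fun i => ?_, fun i => ?_, ?_⟩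
    -- Contrapositive of the guarantee of RoundRobin: a threshold below the share would have been
    -- met.
    · by_contra! hlt
      obtain ⟨hi₁, hi₂⟩ := mem_unsatisfied.1 hi
      exact hi₂.not_ge (hP.le_value hn hc₀ hc (hv i) hi₁ hlt.le)
    · by_cases hiV : i ∈ unsatisfied c v τ P
      · rw [hin i hiV, ← mul_assoc, mul_one_div_cancel hpos.ne', one_mul]
        exact h₁ i hiV
      · rw [hout i hiV]
        exact h₂ i hi
    · simp only
      split_ifs with hiV
      · rw [hin i hiV, he i, pow_succ']
        ring
      · rw [hout i hiV, he i]
    · have := hek i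
      simp only
      split_ifs <;> omega
    · obtain ⟨i, hi⟩ := hV
      refine Nat.succ_le_of_lt (hke.trans_lt (Finset.sum_lt_sum (fun j _ => ?_)
        ⟨i, (mem_unsatisfied.1 hi).1, by simp [hi]⟩))
      split_ifs <;> omega

/-- Take logarithms in `(1 + δ)^e * μ ≤ (1 + δ) * a`. The summand 1 accounts for the last division,
which may overshoot `μ`. -/
theorem le_one_add_logb (hδ : 0 < δ) {a μ τ : ℝ} (hμ : 0 < μ) {e : ℕ}
    (hτ : τ = (1 / (1 + δ)) ^ e * a) (h : μ ≤ (1 + δ) * τ) :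
    (e : ℝ) ≤ 1 + Real.logb (1 + δ) (a / μ) := by
  have hpos : 0 < 1 + δ := by linarith
  have h1 : (1 + δ) ^ e * μ ≤ (1 + δ) * a := by
    rw [hτ, one_div, inv_pow] at h
    have hp : 0 < (1 + δ) ^ e := by positivity
    calc (1 + δ) ^ e * μ ≤ (1 + δ) ^ e * ((1 + δ) * (((1 + δ) ^ e)⁻¹ * a)) := by gcongr
      _ = (1 + δ) * a := by field_simp
  have ha : 0 < a := by
    have : 0 < (1 + δ) ^ e * μ := by positivity
    nlinarith
  have h2 : Real.logb (1 + δ) ((1 + δ) ^ e) ≤ Real.logb (1 + δ) ((1 + δ) * (a / μ)) := by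
    refine Real.logb_le_logb_of_le (by linarith) (by positivity) ?_
    rw [← mul_div_assoc, le_div_iff₀ hμ]
    exact h1
  rw [Real.logb_pow, Real.logb_mul hpos.ne' (by positivity),
    Real.logb_self_eq_one (by linarith), mul_one] at h2
  exact h2

theorem Reaches.le_sum_logb (hn : 1 ≤ n) (hv : ∀ i, IsValuation (v i)) (hc₀ : 0 ≤ c)
    (hc : c ≤ 1 / 3) (hδ : 0 < δ) {k : ℕ} {τ : Fin n → ℝ} {P : Fin n → Finset (Fin m)}
    (h : Reaches c δ v k τ P) :
    (k : ℝ) ≤ ∑ i ∈ active v, (1 + Real.logb (1 + δ) (v i Finset.univ / share v i)) := by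
  obtain ⟨-, h₂, e, he, -, hke⟩ := h.spec hn hv hc₀ hc hδ
  calc (k : ℝ) ≤ ∑ i ∈ active v, (e i : ℝ) := by exact_mod_cast hke
    _ ≤ _ := Finset.sum_le_sum fun i hi =>
      le_one_add_logb hδ (mem_active.1 hi) (he i) (h₂ i hi)

/-- The condition `ρ * (1 + δ) ≤ c` absorbs the factor `1 + δ` by which a final threshold may lie
below the share. -/
theorem Returns.spec (hn : 1 ≤ n) (hv : ∀ i, IsValuation (v i)) (hc₀ : 0 ≤ c)
    (hc : c ≤ 1 / 3) (hδ : 0 < δ) {ρ : ℝ} (hρ₀ : 0 ≤ ρ) (hρ : ρ * (1 + δ) ≤ c)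
    {P : Fin n → Finset (Fin m)} (h : Returns c δ v P) :
    IsPartition Finset.univ P ∧ ∀ i, ρ * share v i ≤ v i (P i) := by
  obtain ⟨k, τ, P₀, hr, hV, hP, hsub⟩ := h
  refine ⟨hP, fun i => ?_⟩
  by_cases hi : i ∈ active v
  · obtain ⟨-, h₂, -⟩ := hr.spec hn hv hc₀ hc hδ
    have h₃ : c * τ i ≤ v i (P₀ i) := by
      by_contra! hlt
      have := mem_unsatisfied.2 ⟨hi, hlt⟩
      simp [hV] at this
    have h₄ := h₂ i hi
    have h₅ := mem_active.1 hi
    have hτ : 0 ≤ τ i := by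
      by_contra! hneg
      nlinarith
    calc ρ * share v i ≤ ρ * ((1 + δ) * τ i) := by gcongr
      _ = ρ * (1 + δ) * τ i := by ring
      _ ≤ c * τ i := by gcongr
      _ ≤ v i (P₀ i) := h₃
      _ ≤ v i (P i) := (hv i).mono _ _ (hsub i)
  · rw [mem_active, not_lt] at hi
    exact (mul_nonpos_of_nonneg_of_nonpos hρ₀ hi).trans ((hv i).nonneg _)

end AlgSub

/-! ### Reading the memory -/

section Decoding

variable {n m : ℕ}

/-- The bundle of agent `i` when cell `j` of `o` holds the owner of good `j`. -/
def bundleOf (o : ℕ → ℕ) (i : Fin n) : Finset (Fin m) := Finset.univ.filter fun j => o j = i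

/-- The set of goods that is encoded in `s`. -/
def goodsOf (s : ℕ → ℕ) : Finset (Fin m) := Finset.univ.filter fun j => s j ≠ 0

/-- The state of RoundRobin that is encoded in an array of owners, with values from `n` on for
unallocated goods, and an array that tells which agents are present. -/
def rrState (o p : ℕ → ℕ) : RRState n m where
  agents := Finset.univ.filter fun i => p i ≠ 0
  goods := Finset.univ.filter fun j => n ≤ o j
  bundle := bundleOf o

theorem mem_bundleOf {o : ℕ → ℕ} {i : Fin n} {j : Fin m} : j ∈ bundleOf o i ↔ o j = i := by
  simp [bundleOf]

theorem mem_rrState_agents {o p : ℕ → ℕ} {i : Fin n} :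
    i ∈ (rrState o p : RRState n m).agents ↔ p i ≠ 0 := by
  simp [rrState]

theorem mem_rrState_goods {o p : ℕ → ℕ} {j : Fin m} :
    j ∈ (rrState o p : RRState n m).goods ↔ n ≤ o j := by
  simp [rrState]

theorem goodsOf_congr {s s' : ℕ → ℕ} (h : ∀ j < m, s j = s' j) :
    (goodsOf s : Finset (Fin m)) = goodsOf s' := by
  simp [goodsOf, h]

theorem goodsOf_update (s : ℕ → ℕ) (j : Fin m) :
    goodsOf (Function.update s j 1) = insert j (goodsOf s) := by
  ext k
  by_cases hk : k = j
  · simp [goodsOf, hk]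
  · have : (k : ℕ) ≠ j := fun h => hk (Fin.ext h)
    simp [goodsOf, hk, this]

theorem bundleOf_congr {o o' : ℕ → ℕ} (h : ∀ j < m, o j = o' j) :
    (bundleOf o : Fin n → Finset (Fin m)) = bundleOf o' := by
  funext i
  simp [bundleOf, h]

theorem bundleOf_const : (bundleOf (fun _ => n) : Fin n → Finset (Fin m)) = fun _ => ∅ := by
  funext i
  ext j
  simpa [mem_bundleOf] using i.2.ne'

theorem bundleOf_update {o : ℕ → ℕ} {g : Fin m} (hg : n ≤ o g) (i : Fin n) :
    (bundleOf (Function.update o g i) : Fin n → Finset (Fin m)) =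
      Function.update (bundleOf o) i (insert g (bundleOf o i)) := by
  funext k
  ext j
  have hinj : (j : ℕ) = g ↔ j = g := Fin.ext_iff.symm
  by_cases hk : k = i
  · subst hk
    rw [Function.update_self, Finset.mem_insert, mem_bundleOf, mem_bundleOf,
      Function.update_apply]
    by_cases hj : j = g <;> simp [hinj, hj]
  · rw [Function.update_of_ne hk, mem_bundleOf, mem_bundleOf, Function.update_apply]
    by_cases hj : j = g
    · subst hj
      have h1 : (i : ℕ) ≠ k := fun h => hk (Fin.ext h).symm
      have h2 : o j ≠ k := by omega
      simp [h1, h2]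
    · simp [hinj, hj]

theorem rrState_update {o p : ℕ → ℕ} {g : Fin m} (hg : n ≤ o g) (i : Fin n) :
    (rrState (Function.update o g i) p : RRState n m) =
      ⟨(rrState o p : RRState n m).agents, (rrState o p : RRState n m).goods.erase g,
        Function.update (rrState o p).bundle i (insert g ((rrState o p).bundle i))⟩ := by
  simp only [rrState, RRState.mk.injEq, true_and]
  refine ⟨?_, bundleOf_update hg i⟩
  ext j
  have hinj : (j : ℕ) = g ↔ j = g := Fin.ext_iff.symm
  by_cases hj : j = g <;> simp [Function.update_apply, hinj, hj]

theorem rrState_update_present (o p : ℕ → ℕ) (i : Fin n) :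
    (rrState o (Function.update p i 0) : RRState n m) =
      ⟨(rrState o p : RRState n m).agents.erase i, (rrState o p : RRState n m).goods,
        (rrState o p).bundle⟩ := by
  simp only [rrState, RRState.mk.injEq, and_true]
  ext k
  have hinj : (k : ℕ) = i ↔ k = i := Fin.ext_iff.symm
  by_cases hk : k = i <;> simp [Function.update_apply, hinj, hk]

theorem rrState_congr {o o' p p' : ℕ → ℕ} (h : ∀ j < m, o j = o' j) (h' : ∀ i < n, p i = p' i) :
    (rrState o p : RRState n m) = rrState o' p' := by
  simp [rrState, h, h', bundleOf_congr h]

end Decoding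

/-! ### The program

The integer arrays are used as follows: `2` holds the owners of the goods (`n` for unallocated
ones), `3` the set of goods for the next query, `4` the presence of the agents in RoundRobin, `5`
the active agents; the scalars `6`, `7`, `8` and `12` are counters for goods, agents, rounds and
cells, `9` tells whether some agent is unsatisfied, `10` is the best good found and `11` a number of
goods. The number array `0` holds the thresholds, the scalars `1` and `2` the answer to the last
query and the best value found. -/

/-- The value of agent `[7]` for the current query set with good `[6]` added. -/
def queryInsert : Prog :=
  .seq (.setNat 3 (scalar 6) (.lit 1))
    (.seq (.query 1 (.lit 0) (scalar 7) 3) (.setNat 3 (scalar 6) (.lit 0)))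

/-- Makes the bundle of agent `[7]` the query set. -/
def loadBundle : Prog :=
  mapArray 1 3 (.sub (.lit 1)
    (.add (.sub (entry 2 12) (scalar 7)) (.sub (scalar 7) (entry 2 12))))

/-- Values of the enlarged bundle are compared instead of marginals, since the subtracted term is
common. The comparison is non-strict so that the first available good beats the initial best value
0. -/
def bestGoodStep : Prog :=
  .ite (.natLe (scalar 0) (entry 2 6))
    (.seq queryInsert
      (.ite (.numLe (.cell 2 (.lit 0)) (.cell 1 (.lit 0)))
        (.seq (.setNum 2 (.lit 0) (.cell 1 (.lit 0))) (.setNat 10 (.lit 0) (scalar 6))) .skip))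
    .skip

/-- Agent `[7]` picks an unallocated good of maximum marginal value (cell `m` of the owner array is
written to if there is none). -/
def pick : Prog :=
  .seq loadBundle (.seq (.setNum 2 (.lit 0) (.lit 0)) (.seq (.setNat 10 (.lit 0) (scalar 1))
    (.seq (forLoop 6 1 bestGoodStep) (.setNat 2 (scalar 10) (scalar 7)))))

def greedyRound : Prog := forLoop 7 0 (.ite (.natLe (.lit 1) (entry 4 7)) pick .skip)

/-- As many rounds as there are goods suffice: a round with a good and an agent left allocates at
least one good, and superfluous rounds do nothing. -/
def greedyPhase : Prog := forLoop 8 1 greedyRound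

def singletonStep (c : ℚ) : Prog :=
  .ite (.natLe (.lit 1) (entry 4 7))
    (.ite (.natLe (scalar 0) (entry 2 6))
      (.seq queryInsert
        (.ite (.numLe (.mul (.lit c) (.cell 0 (scalar 7))) (.cell 1 (.lit 0)))
          (.seq (.setNat 2 (scalar 6) (scalar 7)) (.setNat 4 (scalar 7) (.lit 0))) .skip))
      .skip)
    .skip

/-- One pass over all pairs is enough. A rejected pair stays rejected, because values of singletons
and thresholds are fixed and agents and goods only disappear. -/
def singletonPhase (c : ℚ) : Prog :=
  .seq (mapArray 1 3 (.lit 0)) (forLoop 7 0 (forLoop 6 1 (singletonStep c)))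

/-- Makes all goods unallocated. -/
def clearOwners : Prog := mapArray 1 2 (scalar 0)

/-- Gives all unallocated goods to agent `0`. -/
def fillOwners : Prog :=
  mapArray 1 2 (.mul (entry 2 12)
    (.sub (.lit 1) (.sub (.add (entry 2 12) (.lit 1)) (scalar 0))))

def roundRobin (c : ℚ) : Prog :=
  .seq clearOwners (.seq (mapArray 0 4 (entry 5 12))
    (.seq (singletonPhase c) (.seq greedyPhase fillOwners)))

/-! ### Correctness of the RoundRobin program -/

section Correctness

variable {n m : ℕ} {len : ℝ → ℕ} {B : ℕ} {v : Fin n → Finset (Fin m) → ℝ} {σ : Store}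
  {Q : Store → Prop}

theorem answer_eq {a s : ℕ} {i : Fin n} (hi : a = i) :
    answer v σ a s = v i (goodsOf (σ.nat s)) := by
  subst hi
  simp [answer, goodsOf]

theorem runs_queryInsert (hv : OracleBounded len B v) {i : Fin n} {j : Fin m}
    (hi : σ.nat 7 0 = i) (hj : σ.nat 6 0 = j) (h₀ : σ.nat 3 j = 0)
    (hQ : Q (σ.setNum 1 0 (v i (insert j (goodsOf (σ.nat 3)))))) :
    Runs len B v queryInsert σ Q := by
  refine runs_seq (runs_setNat hv.one (runs_seq (runs_query hv (runs_setNat (Nat.zero_le _) ?_))))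
  have hans : answer v (σ.setNat 3 j 1) ((scalar 7).eval (σ.setNat 3 j 1)) 3 =
      v i (insert j (goodsOf (σ.nat 3))) := by
    rw [answer_eq (i := i) (by simpa using hi), Store.nat_setNat_self, goodsOf_update]
  -- Cell `j` was 0 before, so resetting it restores the query array and only the answer remains as
  -- an effect.
  have hσ : ((((σ.setNat 3 j 1).setNum 1 0 (v i (insert j (goodsOf (σ.nat 3))))).setNat 3 j 0)) =
      σ.setNum 1 0 (v i (insert j (goodsOf (σ.nat 3)))) := by
    simp [Store.setNat, Store.setNum, ← h₀]
  simp only [NExpr.eval, hj, Store.nat_setNum, Store.nat_setNat_of_ne _ _ _ (by decide : 6 ≠ 3)]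
    at hans ⊢
  rw [hans, hσ]
  exact hQ

theorem runs_loadBundle (hv : OracleBounded len B v) (hm : σ.nat 1 0 = m) {i : Fin n}
    (hi : σ.nat 7 0 = i)
    (hQ : ∀ σ', Agree loadBundle σ σ' →
      (∀ j < m, σ'.nat 3 j = if σ.nat 2 j = i then 1 else 0) → Q σ') :
    Runs len B v loadBundle σ Q := by
  refine runs_mapArray (by decide) (by decide) (by decide) hm _ (fun k σ' hk ha hc _ => ?_) hQ
  have h2 : σ'.nat 2 = σ.nat 2 := ha.1 2 rfl
  have h7 : σ'.nat 7 = σ.nat 7 := ha.1 7 rfl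
  -- With truncated subtraction, `1 - ((o - i) + (i - o))` is the indicator of `o = i`.
  simp only [NExpr.eval, hc, h2, h7, hi]
  have := hv.one
  split_ifs <;> omega

/-- If no good is available, only the encoded state is claimed to be unchanged, not the array, as a
cell beyond the goods is overwritten. The array `p` is arbitrary because picking does not change
which agents are present. -/
theorem runs_pick (hv : OracleBounded len B v) (hv₀ : ∀ i S, 0 ≤ v i S) (hn : σ.nat 0 0 = n)
    (hm : σ.nat 1 0 = m) {i : Fin n} (hi : σ.nat 7 0 = i) (p : ℕ → ℕ)
    (hQ : ∀ σ', Agree pick σ σ' →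
      ((∀ j : Fin m, ¬ n ≤ σ.nat 2 j) ∧
          (rrState (σ'.nat 2) p : RRState n m) = rrState (σ.nat 2) p ∨
        ∃ g : Fin m, n ≤ σ.nat 2 g ∧
          (∀ j : Fin m, n ≤ σ.nat 2 j → v i (insert j (bundleOf (σ.nat 2) i)) ≤
            v i (insert g (bundleOf (σ.nat 2) i))) ∧
          σ'.nat 2 = Function.update (σ.nat 2) g i) → Q σ') :
    Runs len B v pick σ Q := by
  suffices H : Runs len B v pick σ fun σ' =>
      ((∀ j : Fin m, ¬ n ≤ σ.nat 2 j) ∧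
          (rrState (σ'.nat 2) p : RRState n m) = rrState (σ.nat 2) p ∨
        ∃ g : Fin m, n ≤ σ.nat 2 g ∧
          (∀ j : Fin m, n ≤ σ.nat 2 j → v i (insert j (bundleOf (σ.nat 2) i)) ≤
            v i (insert g (bundleOf (σ.nat 2) i))) ∧
          σ'.nat 2 = Function.update (σ.nat 2) g i) from H.weaken hQ
  refine runs_seq (runs_loadBundle hv hm hi fun σ₁ ha₁ hs => ?_)
  have h10 : σ₁.nat 0 = σ.nat 0 := ha₁.1 0 rfl
  have h11 : σ₁.nat 1 = σ.nat 1 := ha₁.1 1 rfl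
  have h12 : σ₁.nat 2 = σ.nat 2 := ha₁.1 2 rfl
  have h17 : σ₁.nat 7 = σ.nat 7 := ha₁.1 7 rfl
  have hgoods : (goodsOf (σ₁.nat 3) : Finset (Fin m)) = bundleOf (σ.nat 2) i := by
    ext j
    rw [mem_bundleOf, goodsOf, Finset.mem_filter, hs j j.2]
    by_cases h : σ.nat 2 j = i <;> simp [h]
  refine runs_seq (runs_setNum (by simpa [RExpr.Short] using hv.zero)
    (fun _ => by simpa using hv.zero) (runs_seq (runs_setNat
      (by simpa [h11, hm] using hv.goods) (runs_seq ?_))))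
  set o := σ.nat 2
  set s := σ₁.nat 3
  refine runs_forLoop (N := m) rfl rfl (by decide) (by simpa [h11] using hm)
    (fun k σ' => σ'.nat 3 = s ∧
      (∀ j : Fin m, j < k → n ≤ o j → v i (insert j (bundleOf o i)) ≤ σ'.num 2 0) ∧
      ((σ'.num 2 0 = 0 ∧ σ'.nat 10 0 = m ∧ ∀ j : Fin m, j < k → ¬ n ≤ o j) ∨
        ∃ g : Fin m, n ≤ o g ∧ σ'.nat 10 0 = g ∧ σ'.num 2 0 = v i (insert g (bundleOf o i))))
    ?_ ?_ ?_
  · simp [s, h11, hm]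
  · rintro k σ' hk ha hc ⟨hI₁, hI₂, hI₃⟩
    obtain ⟨j, rfl⟩ : ∃ j : Fin m, (j : ℕ) = k := ⟨⟨k, hk⟩, rfl⟩
    have h0 : σ'.nat 0 0 = n := by rw [ha.1 0 rfl]; simp [h10, hn]
    have h2 : σ'.nat 2 = o := by rw [ha.1 2 rfl]; simp [h12, o]
    have h7 : σ'.nat 7 0 = i := by rw [ha.1 7 rfl]; simp [h17, hi]
    have hj' : ∀ l : Fin m, (l : ℕ) < j + 1 → l = j ∨ (l : ℕ) < j := fun l hl =>
      (Nat.lt_succ_iff_lt_or_eq.1 hl).symm.imp_left Fin.ext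
    refine runs_ite trivial (fun hb => ?_) fun hb => runs_skip ?_
    · have hb : n ≤ o j := by simpa [Test.holds, hc, h0, h2] using hb
      have hsj : σ'.nat 3 j = 0 := by
        rw [hI₁, hs j j.2, if_neg]
        have := i.2
        omega
      refine runs_seq (runs_queryInsert hv h7 hc hsj ?_)
      rw [hI₁, hgoods]
      refine runs_ite ⟨trivial, trivial⟩ (fun hb' => ?_) fun hb' => runs_skip ?_
      · have hb' : σ'.num 2 0 ≤ v i (insert j (bundleOf o i)) := by simpa [Test.holds] using hb'
        refine runs_seq (runs_setNum trivial (fun h => h.num _ _) (runs_setNat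
          (by simpa [hc] using j.2.le.trans hv.goods) ?_))
        refine ⟨by simp [hI₁], fun l hl hol => ?_, Or.inr ⟨j, hb, by simp [hc], by simp⟩⟩
        rcases hj' l hl with rfl | hl
        · simp
        · simpa using (hI₂ l hl hol).trans hb'
      · have hb' : ¬ σ'.num 2 0 ≤ v i (insert j (bundleOf o i)) := by
          simpa [Test.holds] using hb'
        -- A failed comparison shows that the best value is not the initial 0, by nonnegativity.
        have hI₃' := hI₃.resolve_left fun h => hb' (h.1.trans_le (hv₀ _ _))
        refine ⟨by simp [hI₁], fun l hl hol => ?_, Or.inr (by simpa using hI₃')⟩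
        rcases hj' l hl with rfl | hl
        · simpa using (not_le.1 hb').le
        · simpa using hI₂ l hl hol
    · have hb : ¬ n ≤ o j := by simpa [Test.holds, hc, h0, h2] using hb
      refine ⟨by simp [hI₁], fun l hl hol => ?_, ?_⟩
      · rcases hj' l hl with rfl | hl
        · exact absurd hol hb
        · simpa using hI₂ l hl hol
      · refine hI₃.imp (fun h => ⟨by simpa using h.1, by simpa using h.2.1, fun l hl => ?_⟩)
          fun h => by simpa using h
        rcases hj' l hl with rfl | hl
        exacts [hb, h.2.2 l hl]
  · rintro σ' ha ⟨-, hI₂, hI₃⟩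
    have h2 : σ'.nat 2 = o := by rw [ha.1 2 rfl]; simp [h12, o]
    have h7 : σ'.nat 7 0 = i := by rw [ha.1 7 rfl]; simp [h17, hi]
    refine runs_setNat (by simpa [h7] using i.2.le.trans hv.agents) ?_
    simp only [NExpr.eval, h7, Store.nat_setNat_self, h2]
    rcases hI₃ with ⟨-, hb, hno⟩ | ⟨g, hg, hb, hval⟩
    · refine Or.inl ⟨fun j => hno j j.2, ?_⟩
      rw [hb]
      exact rrState_congr (fun j hj => Function.update_of_ne hj.ne _ _) fun _ _ => rfl
    · exact Or.inr ⟨g, hg, fun j hj => (hI₂ j j.2 hj).trans_eq hval, by rw [hb]⟩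

theorem Round.eq_of_goods_eq_empty {l : List (Fin n)} {s t : RRState n m} (h : Round v l s t)
    (hs : s.goods = ∅ ∨ l = []) : t = s := by
  cases h with
  | nil => rfl
  | exhausted => rfl
  | pick i l s t g hg => simp [Finset.ne_empty_of_mem hg] at hs

theorem Round.card_goods_lt {l : List (Fin n)} {s t : RRState n m} (h : Round v l s t)
    (hs : s.goods.Nonempty) (hl : l ≠ []) : t.goods.card < s.goods.card := by
  cases h with
  | nil => exact absurd rfl hl
  | exhausted _ _ h => exact absurd h hs.ne_empty
  | pick i l s t g hg hmax ht =>
    exact (Finset.card_le_card ht.spec.1).trans_lt (Finset.card_erase_lt_of_mem hg)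

/-- The agents that are present, in increasing order, starting from number `k`. -/
def presentFrom (p : ℕ → ℕ) (k : ℕ) : List (Fin n) :=
  ((List.finRange n).drop k).filter fun i => p i ≠ 0

theorem presentFrom_eq (p : ℕ → ℕ) (i : Fin n) :
    (presentFrom p i : List (Fin n)) =
      if p i ≠ 0 then i :: presentFrom p (i + 1) else presentFrom p (i + 1) := by
  rw [presentFrom, List.drop_eq_getElem_cons (by simp), List.filter_cons]
  simp [presentFrom]

theorem presentFrom_self (p : ℕ → ℕ) : (presentFrom p n : List (Fin n)) = [] := by
  rw [presentFrom, List.drop_of_length_le (by simp), List.filter_nil]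

/-- `Round` is built from its first pick, whereas the program moves forward. The invariant is
therefore a continuation: any completion from the current state yields a complete round from the
initial one. The greedy and singleton phases use the same device. -/
theorem runs_greedyRound (hv : OracleBounded len B v) (hv₀ : ∀ i S, 0 ≤ v i S)
    (hn : σ.nat 0 0 = n) (hm : σ.nat 1 0 = m)
    (hQ : ∀ σ', Agree greedyRound σ σ' → Round v (presentFrom (σ.nat 4) 0)
      (rrState (σ.nat 2) (σ.nat 4)) (rrState (σ'.nat 2) (σ.nat 4)) → Q σ') :
    Runs len B v greedyRound σ Q := by
  set p := σ.nat 4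
  refine runs_forLoop rfl rfl (by decide) hn
    (fun k σ' => ∀ t, Round v (presentFrom p k) (rrState (σ'.nat 2) p) t →
      Round v (presentFrom p 0) (rrState (σ.nat 2) p) t) ?_ ?_ ?_
  · simp
  · intro k σ' hk ha hc hI
    obtain ⟨i, rfl⟩ : ∃ i : Fin n, (i : ℕ) = k := ⟨⟨k, hk⟩, rfl⟩
    have h0 : σ'.nat 0 0 = n := by rw [ha.1 0 rfl]; exact hn
    have h1 : σ'.nat 1 0 = m := by rw [ha.1 1 rfl]; exact hm
    have h4 : σ'.nat 4 = p := ha.1 4 rfl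
    rw [presentFrom_eq] at hI
    refine runs_ite trivial (fun hb => ?_) fun hb => runs_skip ?_
    · have hb : p i ≠ 0 := by
        simpa [Test.holds, hc, h4, Nat.one_le_iff_ne_zero] using hb
      rw [if_pos hb] at hI
      refine runs_pick hv hv₀ h0 h1 hc p fun σ₂ ha₂ h => ?_
      intro t ht
      rw [Store.nat_setNat_of_ne _ _ _ (by decide)] at ht
      refine hI t ?_
      rcases h with ⟨hno, heq⟩ | ⟨g, hg, hmax, heq⟩
      · have hemp : (rrState (σ'.nat 2) p : RRState n m).goods = ∅ :=
          Finset.eq_empty_of_forall_notMem fun j hj => hno j (mem_rrState_goods.1 hj)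
        rw [heq] at ht
        rw [ht.eq_of_goods_eq_empty (Or.inl hemp)]
        exact .exhausted _ _ hemp
      · rw [heq, rrState_update hg] at ht
        exact .pick i _ _ t g (mem_rrState_goods.2 hg)
          (fun j hj => sub_le_sub_right (hmax j (mem_rrState_goods.1 hj)) _) ht
    · have hb : ¬ p i ≠ 0 := by
        simpa [Test.holds, hc, h4, Nat.one_le_iff_ne_zero] using hb
      rw [if_neg hb] at hI
      simpa using hI
  · intro σ' ha hI
    refine hQ σ' ha (hI _ ?_)
    rw [presentFrom_self]
    exact .nil _

theorem runs_greedyPhase (hv : OracleBounded len B v) (hv₀ : ∀ i S, 0 ≤ v i S)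
    (hn : σ.nat 0 0 = n) (hm : σ.nat 1 0 = m)
    (hQ : ∀ σ', Agree greedyPhase σ σ' → GreedyPhase v (presentFrom (σ.nat 4) 0)
      (rrState (σ.nat 2) (σ.nat 4)) (rrState (σ'.nat 2) (σ.nat 4)) → Q σ') :
    Runs len B v greedyPhase σ Q := by
  set p := σ.nat 4
  set l : List (Fin n) := presentFrom p 0
  refine runs_forLoop rfl rfl (by decide) hm
    (fun k σ' => (∀ u, GreedyPhase v l (rrState (σ'.nat 2) p) u →
        GreedyPhase v l (rrState (σ.nat 2) p) u) ∧
      (((rrState (σ'.nat 2) p : RRState n m).goods = ∅ ∨ l = []) ∨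
        (rrState (σ'.nat 2) p : RRState n m).goods.card + k ≤ m)) ?_ ?_ ?_
  · refine ⟨by simp, Or.inr ?_⟩
    simpa using Finset.card_le_univ (rrState (σ.nat 2) p : RRState n m).goods
  · rintro k σ' hk ha hc ⟨hI₁, hI₂⟩
    have h0 : σ'.nat 0 0 = n := by rw [ha.1 0 rfl]; exact hn
    have h1 : σ'.nat 1 0 = m := by rw [ha.1 1 rfl]; exact hm
    have h4 : σ'.nat 4 = p := ha.1 4 rfl
    refine runs_greedyRound hv hv₀ h0 h1 fun σ₂ ha₂ hr => ?_
    rw [h4] at hr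
    rw [Store.nat_setNat_of_ne _ _ _ (by decide)]
    by_cases hfin : (rrState (σ'.nat 2) p : RRState n m).goods = ∅ ∨ l = []
    · rw [hr.eq_of_goods_eq_empty hfin]
      exact ⟨hI₁, Or.inl hfin⟩
    · have hI₂' := hI₂.resolve_left hfin
      rw [not_or, ← Ne, ← Finset.nonempty_iff_ne_empty] at hfin
      have := hr.card_goods_lt hfin.1 hfin.2
      exact ⟨fun u hu => hI₁ u (.round _ _ u hfin.1 hfin.2 hr hu), Or.inr (by omega)⟩
  · rintro σ' ha ⟨hI₁, hI₂⟩
    refine hQ σ' ha (hI₁ _ (.finish _ (hI₂.elim id fun h => Or.inl ?_)))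
    exact Finset.card_eq_zero.1 (by omega)

theorem runs_singletonPhase {c : ℚ} (hv : OracleBounded len B v)
    (hn : σ.nat 0 0 = n) (hm : σ.nat 1 0 = m) (hc : len c ≤ B)
    (hcτ : ∀ i : Fin n, len (c * σ.num 0 i) ≤ B)
    (hbun : ∀ i, i ∈ (rrState (σ.nat 2) (σ.nat 4) : RRState n m).agents →
      (rrState (σ.nat 2) (σ.nat 4) : RRState n m).bundle i = ∅)
    (hQ : ∀ σ', Agree (singletonPhase c) σ σ' → SingletonPhase c v (fun i => σ.num 0 i)
      (rrState (σ.nat 2) (σ.nat 4)) (rrState (σ'.nat 2) (σ'.nat 4)) → Q σ') :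
    Runs len B v (singletonPhase c) σ Q := by
  suffices H : Runs len B v (singletonPhase c) σ fun σ' =>
      SingletonPhase c v (fun i => σ.num 0 i)
      (rrState (σ.nat 2) (σ.nat 4)) (rrState (σ'.nat 2) (σ'.nat 4)) from H.weaken hQ
  refine runs_seq (runs_mapArray (by decide) (by decide) (by decide) hm (fun _ => 0)
    (fun _ _ _ _ _ _ => ⟨rfl, Nat.zero_le _⟩) fun σ₁ ha₁ hs => ?_)
  have h10 : σ₁.nat 0 0 = n := by rw [ha₁.1 0 rfl]; exact hn
  have h11 : σ₁.nat 1 0 = m := by rw [ha₁.1 1 rfl]; exact hm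
  have h12 : σ₁.nat 2 = σ.nat 2 := ha₁.1 2 rfl
  have h14 : σ₁.nat 4 = σ.nat 4 := ha₁.1 4 rfl
  have h1τ : σ₁.num 0 = σ.num 0 := ha₁.2 0 rfl
  have hτ : ∃ τ : Fin n → ℝ, τ = fun i : Fin n => σ.num 0 i := ⟨_, rfl⟩
  obtain ⟨τ, hτ⟩ := hτ
  rw [← hτ]
  have hτi : ∀ i : Fin n, σ.num 0 i = τ i := fun i => by rw [hτ]
  -- The last clause says that pairs lexicographically before `(k, k')`, with agent and good both
  -- still present, fail the test. Empty bundles of present agents make adding `j` the same as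
  -- assigning `{j}`.
  let I : ℕ → ℕ → Store → Prop := fun k k' σ' => (∀ j < m, σ'.nat 3 j = 0) ∧
    (∀ t, SingletonPhase c v τ (rrState (σ'.nat 2) (σ'.nat 4)) t →
      SingletonPhase c v τ (rrState (σ.nat 2) (σ.nat 4)) t) ∧
    (∀ i, i ∈ (rrState (σ'.nat 2) (σ'.nat 4) : RRState n m).agents →
      (rrState (σ'.nat 2) (σ'.nat 4) : RRState n m).bundle i = ∅) ∧
    ∀ i ∈ (rrState (σ'.nat 2) (σ'.nat 4) : RRState n m).agents,
      ∀ j ∈ (rrState (σ'.nat 2) (σ'.nat 4) : RRState n m).goods,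
        (i < k ∨ (i : ℕ) = k ∧ j < k') → v i {j} < c * τ i
  refine runs_forLoop rfl rfl (by decide) h10 (fun k σ' => I k 0 σ') ?_ ?_ ?_
  · refine ⟨by simpa using hs, by simp [h12, h14], by simpa [h12, h14] using hbun, ?_⟩
    intro i _ j _ h
    omega
  · intro k σ₂ hk ha₂ hck hI₂
    obtain ⟨i, rfl⟩ : ∃ i : Fin n, (i : ℕ) = k := ⟨⟨k, hk⟩, rfl⟩
    have h20 : σ₂.nat 0 0 = n := by rw [ha₂.1 0 rfl]; exact h10
    have h21 : σ₂.nat 1 0 = m := by rw [ha₂.1 1 rfl]; exact h11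
    have h2τ : σ₂.num 0 = σ.num 0 := (ha₂.2 0 rfl).trans h1τ
    refine runs_forLoop rfl rfl (by decide) h21 (fun k' σ' => I i k' σ') ?_ ?_ ?_
    · simpa [I] using hI₂
    · rintro k' σ' hk' ha hck' ⟨hI₁, hI₂, hI₃, hI₄⟩
      obtain ⟨j, rfl⟩ : ∃ j : Fin m, (j : ℕ) = k' := ⟨⟨k', hk'⟩, rfl⟩
      have h0 : σ'.nat 0 0 = n := by rw [ha.1 0 rfl]; exact h20
      have h7 : σ'.nat 7 0 = i := by rw [ha.1 7 rfl]; exact hck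
      have hτ' : σ'.num 0 i = τ i := by rw [ha.2 0 rfl, h2τ, hτi]
      -- what is left to show when the step does nothing
      have hskip : ∀ σ₃ : Store, σ₃.nat = σ'.nat →
          (i ∈ (rrState (σ'.nat 2) (σ'.nat 4) : RRState n m).agents →
            j ∈ (rrState (σ'.nat 2) (σ'.nat 4) : RRState n m).goods → v i {j} < c * τ i) →
          I i (j + 1) (σ₃.setNat 6 0 (j + 1)) := by
        intro σ₃ h₃ hij
        refine ⟨by simpa [h₃] using hI₁, by simpa [h₃] using hI₂, by simpa [h₃] using hI₃, ?_⟩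
        simp only [ne_eq, not_false_eq_true, Nat.reduceEqDiff,
          Store.nat_setNat_of_ne, h₃]
        intro i' hi' j' hj' h
        by_cases hnew : i' = i ∧ j' = j
        · obtain ⟨rfl, rfl⟩ := hnew
          exact hij hi' hj'
        · refine hI₄ i' hi' j' hj' ?_
          rw [Fin.ext_iff, Fin.ext_iff] at hnew
          omega
      refine runs_ite trivial (fun hb => ?_) fun hb => runs_skip (hskip _ rfl ?_)
      swap
      · intro hi
        exact absurd (mem_rrState_agents.1 hi)
          (by simpa [Test.holds, h7, Nat.one_le_iff_ne_zero] using hb)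
      have hi : σ'.nat 4 i ≠ 0 := by
        simpa [Test.holds, h7, Nat.one_le_iff_ne_zero] using hb
      refine runs_ite trivial (fun hb' => ?_) fun hb' => runs_skip (hskip _ rfl ?_)
      swap
      · intro _ hj
        exact absurd (mem_rrState_goods.1 hj) (by simpa [Test.holds, hck', h0] using hb')
      have hj : n ≤ σ'.nat 2 j := by simpa [Test.holds, hck', h0] using hb'
      refine runs_seq (runs_queryInsert hv h7 hck' (hI₁ j j.2) ?_)
      have hS : (goodsOf (σ'.nat 3) : Finset (Fin m)) = ∅ := by
        rw [goodsOf_congr hI₁]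
        simp [goodsOf]
      rw [hS, insert_empty_eq]
      refine runs_ite ⟨⟨hc, trivial, ?_⟩, trivial⟩ (fun hb => ?_) fun hb => runs_skip
        (hskip _ rfl fun _ _ => ?_)
      · simpa [h7, hτ', ← hτi] using hcτ i
      swap
      · simpa [Test.holds, h7, hτ'] using hb
      have hle : c * τ i ≤ v i {j} := by simpa [Test.holds, h7, hτ'] using hb
      refine runs_seq (runs_setNat (by simpa [h7] using i.2.le.trans hv.agents)
        (runs_setNat (Nat.zero_le _) ?_))
      have hst : (rrState (Function.update (σ'.nat 2) j i) (Function.update (σ'.nat 4) i 0) :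
          RRState n m) = ⟨(rrState (σ'.nat 2) (σ'.nat 4) : RRState n m).agents.erase i,
            (rrState (σ'.nat 2) (σ'.nat 4) : RRState n m).goods.erase j,
            Function.update (rrState (σ'.nat 2) (σ'.nat 4)).bundle i {j}⟩ := by
        rw [rrState_update_present, rrState_update hj, hI₃ i (mem_rrState_agents.2 hi),
          insert_empty_eq]
      simp only [I, NExpr.eval, ne_eq, not_false_eq_true, Nat.reduceEqDiff,
        Store.nat_setNat_of_ne, Store.nat_setNum, Store.nat_setNat_self, h7, hck', hst]
      refine ⟨hI₁, fun t ht => hI₂ t (.step _ t i j (mem_rrState_agents.2 hi)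
        (mem_rrState_goods.2 hj) hle ht), fun i' hi' => ?_, fun i' hi' j' hj' h => ?_⟩
      · rw [Function.update_of_ne (Finset.ne_of_mem_erase hi')]
        exact hI₃ i' (Finset.mem_of_mem_erase hi')
      · have hne := Finset.ne_of_mem_erase hi'
        rw [ne_eq, Fin.ext_iff] at hne
        exact hI₄ i' (Finset.mem_of_mem_erase hi') j' (Finset.mem_of_mem_erase hj') (by omega)
    · rintro σ' - ⟨hI₁, hI₂, hI₃, hI₄⟩
      simp only [I, ne_eq, not_false_eq_true, Nat.reduceEqDiff,
        Store.nat_setNat_of_ne]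
      refine ⟨hI₁, hI₂, hI₃, fun i' hi' j hj h => hI₄ i' hi' j hj ?_⟩
      have := j.2
      omega
  · rintro σ' - ⟨-, hI₂, -, hI₄⟩
    exact hI₂ _ (.finish _ fun i hi j hj => hI₄ i hi j hj (Or.inl i.2))

theorem runs_clearOwners (hv : OracleBounded len B v) (hn : σ.nat 0 0 = n) (hm : σ.nat 1 0 = m)
    (hQ : ∀ σ', Agree clearOwners σ σ' → (∀ j < m, σ'.nat 2 j = n) → Q σ') :
    Runs len B v clearOwners σ Q := by
  refine runs_mapArray (by decide) (by decide) (by decide) hm (fun _ => n)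
    (fun k σ' _ ha _ _ => ⟨?_, hv.agents⟩) hQ
  have h0 : σ'.nat 0 = σ.nat 0 := ha.1 0 rfl
  simp [h0, hn]

theorem runs_fillOwners (hv : OracleBounded len B v) (hn₁ : 1 ≤ n) (hn : σ.nat 0 0 = n)
    (hm : σ.nat 1 0 = m)
    (hQ : ∀ σ', Agree fillOwners σ σ' → (∀ j < m, σ'.nat 2 j < n) →
      IsPartition Finset.univ (bundleOf (σ'.nat 2) : Fin n → Finset (Fin m)) →
      (∀ i : Fin n, (bundleOf (σ.nat 2) i : Finset (Fin m)) ⊆ bundleOf (σ'.nat 2) i) → Q σ') :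
    Runs len B v fillOwners σ Q := by
  refine runs_mapArray (by decide) (by decide) (by decide) hm
    (fun k => if n ≤ σ.nat 2 k then 0 else σ.nat 2 k) (fun k σ' _ ha hc heq => ?_)
    fun σ' ha h => ?_
  · have h0 : σ'.nat 0 = σ.nat 0 := ha.1 0 rfl
    have hB := hv.agents
    -- With truncated subtraction, `1 - (o + 1 - n)` is the indicator of `o < n`, so unallocated
    -- goods go to agent 0.
    simp only [NExpr.eval, hc, heq, h0, hn]
    split_ifs with hle
    · rw [show 1 - (σ.nat 2 k + 1 - n) = 0 by omega]
      simp
    · rw [show 1 - (σ.nat 2 k + 1 - n) = 1 by omega]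
      omega
  · have hlt : ∀ j < m, σ'.nat 2 j < n := by
      intro j hj
      rw [h j hj]
      split_ifs <;> omega
    refine hQ σ' ha hlt ?_ fun i j hj => ?_
    · convert isPartition_filter fun j : Fin m => (⟨σ'.nat 2 j, hlt j j.2⟩ : Fin n) using 1
      funext i
      ext j
      simp [bundleOf, Fin.ext_iff]
    · rw [mem_bundleOf] at hj ⊢
      rw [h j j.2, hj, if_neg (by omega)]

theorem runs_roundRobin {c : ℚ} (hv : OracleBounded len B v) (hv₀ : ∀ i S, 0 ≤ v i S)
    (hn₁ : 1 ≤ n) (hn : σ.nat 0 0 = n) (hm : σ.nat 1 0 = m) {A : Finset (Fin n)}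
    (hA : ∀ i : Fin n, σ.nat 5 i = if i ∈ A then 1 else 0) (hc : len c ≤ B)
    (hcτ : ∀ i : Fin n, len (c * σ.num 0 i) ≤ B)
    (hQ : ∀ σ', Agree (roundRobin c) σ σ' → (∀ j < m, σ'.nat 2 j < n) →
      RoundRobin c v A (fun i => σ.num 0 i) (bundleOf (σ'.nat 2)) → Q σ') :
    Runs len B v (roundRobin c) σ Q := by
  suffices H : Runs len B v (roundRobin c) σ fun σ' => (∀ j < m, σ'.nat 2 j < n) ∧
      RoundRobin c v A (fun i => σ.num 0 i) (bundleOf (σ'.nat 2)) from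
    H.weaken fun σ' ha h => hQ σ' ha h.1 h.2
  refine runs_seq (runs_clearOwners hv hn hm fun σ₁ ha₁ ho => ?_)
  have h10 : σ₁.nat 0 0 = n := by rw [ha₁.1 0 rfl]; exact hn
  have h11 : σ₁.nat 1 0 = m := by rw [ha₁.1 1 rfl]; exact hm
  have h15 : σ₁.nat 5 = σ.nat 5 := ha₁.1 5 rfl
  have h1τ : σ₁.num 0 = σ.num 0 := ha₁.2 0 rfl
  refine runs_seq (runs_mapArray (by decide) (by decide) (by decide) h10 (fun k => σ.nat 5 k)
    (fun k σ' hk ha hck _ => ?_) fun σ₂ ha₂ hp => ?_)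
  · have h5 : σ'.nat 5 = σ.nat 5 := (ha.1 5 rfl).trans h15
    refine ⟨by simp [hck, h5], ?_⟩
    rw [hA ⟨k, hk⟩]
    have := hv.one
    split_ifs <;> omega
  have h20 : σ₂.nat 0 0 = n := by rw [ha₂.1 0 rfl]; exact h10
  have h21 : σ₂.nat 1 0 = m := by rw [ha₂.1 1 rfl]; exact h11
  have h22 : σ₂.nat 2 = σ₁.nat 2 := ha₂.1 2 rfl
  have h2τ : σ₂.num 0 = σ.num 0 := (ha₂.2 0 rfl).trans h1τ
  have hstart : (rrState (σ₂.nat 2) (σ₂.nat 4) : RRState n m) =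
      ⟨A, Finset.univ, fun _ => ∅⟩ := by
    rw [rrState_congr (o' := fun _ => n) (p' := σ.nat 5) (by rw [h22]; exact ho) hp]
    simp only [rrState, RRState.mk.injEq]
    refine ⟨by ext i; simp [hA], by simp, bundleOf_const⟩
  refine runs_seq (runs_singletonPhase hv h20 h21 hc (by simpa [h2τ] using hcτ)
    (by simp [hstart]) fun σ₃ ha₃ hsing => ?_)
  rw [hstart, h2τ] at hsing
  have h30 : σ₃.nat 0 0 = n := by rw [ha₃.1 0 rfl]; exact h20
  have h31 : σ₃.nat 1 0 = m := by rw [ha₃.1 1 rfl]; exact h21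
  refine runs_seq (runs_greedyPhase hv hv₀ h30 h31 fun σ₄ ha₄ hgr => ?_)
  have h40 : σ₄.nat 0 0 = n := by rw [ha₄.1 0 rfl]; exact h30
  have h41 : σ₄.nat 1 0 = m := by rw [ha₄.1 1 rfl]; exact h31
  refine runs_fillOwners hv hn₁ h40 h41 fun σ₅ _ hlt hpart hsub => ⟨hlt, ?_⟩
  refine ⟨_, _, _, hsing, (List.nodup_finRange n).filter _, ?_, hgr, hpart, hsub⟩
  ext i
  simp [rrState]

/-- RoundRobin has a result for all thresholds. -/
theorem exists_roundRobin (c : ℚ) (hv₀ : ∀ i S, 0 ≤ v i S) (hn₁ : 1 ≤ n) (A : Finset (Fin n))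
    (τ : Fin n → ℝ) : ∃ P, RoundRobin c v A τ P := by
  let σ : Store :=
    { nat := fun x k => if x = 0 then n else if x = 1 then m else
        if x = 5 then (if h : k < n then (if ⟨k, h⟩ ∈ A then 1 else 0) else 0) else 0
      num := fun _ k => if h : k < n then τ ⟨k, h⟩ else 0 }
  -- The verified program serves as an existence proof: with all number lengths set to 0, arbitrary
  -- real thresholds may be preloaded and the length conditions are void.
  have hrun : Runs (fun _ => 0) (n + m) v (roundRobin c) σ fun _ => ∃ P, RoundRobin c v A τ P := by
    refine runs_roundRobin (A := A) ⟨fun _ _ => Nat.zero_le _, Nat.zero_le _, by omega, by omega,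
      by omega⟩ hv₀ hn₁ (by simp [σ]) (by simp [σ]) (by simp [σ]) (Nat.zero_le _)
      (fun _ => Nat.zero_le _) fun σ' _ _ h => ⟨bundleOf (σ'.nat 2), ?_⟩
    simpa [σ] using h
  have hσ : σ.Bounded (fun _ => 0) (n + m) := by
    refine ⟨fun x k => ?_, fun _ _ => Nat.zero_le _⟩
    simp only [σ]
    split_ifs <;> omega
  obtain ⟨-, -, -, -, -, h⟩ := hrun hσ
  exact h

end Correctness

/-! ### The program for AlgSub -/

def countStep : Prog :=
  .seq queryInsert (.ite (.numLe (.cell 1 (.lit 0)) (.lit 0)) .skip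
    (.setNat 11 (.lit 0) (.add (scalar 11) (.lit 1))))

/-- Determines the agents for whom at least `n` goods have a positive value. -/
def findActive : Prog :=
  forLoop 7 0 (.seq (.setNat 11 (.lit 0) (.lit 0)) (.seq (forLoop 6 1 countStep)
    (.setNat 5 (scalar 7) (.sub (.lit 1) (.sub (scalar 0) (scalar 11))))))

def initThresholds : Prog :=
  .seq (mapArray 1 3 (.lit 1)) (forLoop 7 0 (.query 0 (scalar 7) (scalar 7) 3))

def updateStep (c r : ℚ) : Prog :=
  .ite (.natLe (.lit 1) (entry 5 7))
    (.seq loadBundle (.seq (.query 1 (.lit 0) (scalar 7) 3)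
      (.ite (.numLe (.mul (.lit c) (.cell 0 (scalar 7))) (.cell 1 (.lit 0))) .skip
        (.seq (.setNum 0 (scalar 7) (.mul (.lit r) (.cell 0 (scalar 7))))
          (.setNat 9 (.lit 0) (.lit 1))))))
    .skip

/-- Multiplies the thresholds of the unsatisfied agents by `r`. -/
def updateThresholds (c r : ℚ) : Prog :=
  .seq (.setNat 9 (.lit 0) (.lit 0)) (forLoop 7 0 (updateStep c r))

def algSubStep (c r : ℚ) : Prog :=
  .seq (updateThresholds c r) (.ite (.natLe (.lit 1) (scalar 9)) (roundRobin c) .skip)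

def algSubLoop (c r : ℚ) : Prog := .loop (.natLe (.lit 1) (scalar 9)) (algSubStep c r)

def algSub (c r : ℚ) : Prog :=
  .seq clearOwners (.seq findActive (.seq initThresholds (.seq (.setNat 9 (.lit 0) (.lit 1))
    (.seq (algSubLoop c r) fillOwners))))

/-! ### Correctness of the AlgSub program -/

section Correctness

variable {n m : ℕ} {len : ℝ → ℕ} {B : ℕ} {v : Fin n → Finset (Fin m) → ℝ} {σ : Store}
  {Q : Store → Prop}

theorem card_filter_lt_succ (p : Fin m → Prop) [DecidablePred p] (j : Fin m) :
    (Finset.univ.filter fun l : Fin m => (l : ℕ) < j + 1 ∧ p l).card =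
      (Finset.univ.filter fun l : Fin m => (l : ℕ) < j ∧ p l).card + if p j then 1 else 0 := by
  have hlt : ∀ l : Fin m, (l : ℕ) < j + 1 ↔ l = j ∨ (l : ℕ) < j := fun l => by
    rw [Fin.ext_iff]
    omega
  split_ifs with h
  · rw [← Finset.card_insert_of_notMem (a := j) (by simp)]
    congr 1
    ext l
    simp only [Finset.mem_filter, Finset.mem_univ, true_and, Finset.mem_insert, hlt]
    constructor
    · rintro ⟨rfl | hl, hp⟩
      exacts [Or.inl rfl, Or.inr ⟨hl, hp⟩]
    · rintro (rfl | ⟨hl, hp⟩)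
      exacts [⟨Or.inl rfl, h⟩, ⟨Or.inr hl, hp⟩]
  · rw [add_zero]
    congr 1
    ext l
    simp only [Finset.mem_filter, Finset.mem_univ, true_and, hlt]
    constructor
    · rintro ⟨rfl | hl, hp⟩
      exacts [absurd hp h, ⟨hl, hp⟩]
    · exact fun ⟨hl, hp⟩ => ⟨Or.inr hl, hp⟩

theorem runs_findActive (hv : OracleBounded len B v) (hval : ∀ i, IsValuation (v i)) (hn₁ : 1 ≤ n)
    (hn : σ.nat 0 0 = n) (hm : σ.nat 1 0 = m) (hs : ∀ j < m, σ.nat 3 j = 0)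
    (hQ : ∀ σ', Agree findActive σ σ' →
      (∀ i : Fin n, σ'.nat 5 i = if i ∈ active v then 1 else 0) → Q σ') :
    Runs len B v findActive σ Q := by
  classical
  refine runs_forLoop rfl rfl (by decide) hn (fun k σ' => (∀ j < m, σ'.nat 3 j = 0) ∧
    ∀ i : Fin n, i < k → σ'.nat 5 i = if i ∈ active v then 1 else 0) ?_ ?_ ?_
  · simpa using hs
  · rintro k σ₁ hk ha₁ hck ⟨hs₁, h5⟩
    obtain ⟨i, rfl⟩ : ∃ i : Fin n, (i : ℕ) = k := ⟨⟨k, hk⟩, rfl⟩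
    have h10 : σ₁.nat 0 0 = n := by rw [ha₁.1 0 rfl]; exact hn
    have h11 : σ₁.nat 1 0 = m := by rw [ha₁.1 1 rfl]; exact hm
    refine runs_seq (runs_setNat (Nat.zero_le _) (runs_seq ?_))
    refine runs_forLoop (N := m) rfl rfl (by decide) (by simpa using h11)
      (fun k' σ' => (∀ j < m, σ'.nat 3 j = 0) ∧ σ'.nat 11 0 =
        (Finset.univ.filter fun l : Fin m => (l : ℕ) < k' ∧ 0 < v i {l}).card) ?_ ?_ ?_
    · simpa using hs₁
    · rintro k' σ' hk' ha hck' ⟨hs', hcount⟩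
      obtain ⟨j, rfl⟩ : ∃ j : Fin m, (j : ℕ) = k' := ⟨⟨k', hk'⟩, rfl⟩
      have h7 : σ'.nat 7 0 = i := by rw [ha.1 7 rfl]; simpa using hck
      have hS : (goodsOf (σ'.nat 3) : Finset (Fin m)) = ∅ := by
        rw [goodsOf_congr hs']
        simp [goodsOf]
      refine runs_seq (runs_queryInsert hv h7 hck' (hs' j j.2) ?_)
      rw [hS, insert_empty_eq]
      refine runs_ite ⟨trivial, by simpa [RExpr.Short] using hv.zero⟩
        (fun hb => runs_skip ?_) fun hb => runs_setNat ?_ ?_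
      · have hb : ¬ 0 < v i {j} := by simpa [Test.holds] using hb
        rw [card_filter_lt_succ, if_neg hb]
        simpa [hcount] using hs'
      all_goals have hb : 0 < v i {j} := by simpa [Test.holds] using hb
      all_goals have hadd := card_filter_lt_succ (fun l : Fin m => 0 < v i {l}) j
      all_goals rw [if_pos hb] at hadd
      · have hle := Finset.card_le_univ (Finset.univ.filter fun l : Fin m =>
          (l : ℕ) < j + 1 ∧ 0 < v i {l})
        rw [Fintype.card_fin] at hle
        have hB := hv.goods
        simp only [NExpr.eval, Store.nat_setNum, hcount]
        omega
      · rw [hadd]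
        simpa [hcount] using hs'
    · rintro σ' ha ⟨hs', hcount⟩
      have h0 : σ'.nat 0 0 = n := by rw [ha.1 0 rfl]; simpa using h10
      have h7 : σ'.nat 7 0 = i := by rw [ha.1 7 rfl]; simpa using hck
      have h5' : σ'.nat 5 = σ₁.nat 5 := by rw [ha.1 5 rfl]; simp
      have hone := hv.one
      refine runs_setNat ?_ ?_
      · simp only [NExpr.eval]
        omega
      · simp only [NExpr.eval, ne_eq, not_false_eq_true, Nat.reduceEqDiff, Store.nat_setNat_of_ne,
          Store.nat_setNat_self, h0, h7, h5', hcount]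
        refine ⟨hs', fun i' hi' => ?_⟩
        by_cases hii : i' = i
        · subst hii
          rw [Function.update_self]
          have hiff : i' ∈ active v ↔
              n ≤ (Finset.univ.filter fun l : Fin m => (l : ℕ) < m ∧ 0 < v i' {l}).card := by
            simp only [Fin.is_lt, true_and]
            rw [mem_active]
            exact maximinShare_pos_iff hn₁ (hval i')
          -- With truncated subtraction, `1 - (n - count)` is 1 exactly when `n ≤ count`.
          split_ifs with hact
          · rw [hiff] at hact
            omega
          · rw [hiff] at hact
            omega
        · have hne : (i' : ℕ) ≠ i := fun h => hii (Fin.ext h)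
          rw [Function.update_of_ne hne]
          exact h5 i' (by omega)
  · rintro σ' ha ⟨-, h5⟩
    exact hQ σ' ha fun i => h5 i i.2

theorem runs_initThresholds (hv : OracleBounded len B v) (hn : σ.nat 0 0 = n)
    (hm : σ.nat 1 0 = m)
    (hQ : ∀ σ', Agree initThresholds σ σ' →
      (∀ i : Fin n, σ'.num 0 i = v i Finset.univ) → Q σ') :
    Runs len B v initThresholds σ Q := by
  suffices H : Runs len B v initThresholds σ fun σ' =>
      ∀ i : Fin n, σ'.num 0 i = v i Finset.univ from H.weaken hQ
  refine runs_seq (runs_mapArray (by decide) (by decide) (by decide) hm (fun _ => 1)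
    (fun _ _ _ _ _ _ => ⟨rfl, hv.one⟩) fun σ₁ ha₁ hs => ?_)
  have h10 : σ₁.nat 0 0 = n := by rw [ha₁.1 0 rfl]; exact hn
  have hS : (goodsOf (σ₁.nat 3) : Finset (Fin m)) = Finset.univ := by
    rw [goodsOf_congr hs]
    simp [goodsOf]
  refine runs_forLoop rfl rfl (by decide) h10
    (fun k σ' => ∀ i : Fin n, i < k → σ'.num 0 i = v i Finset.univ) (by simp) ?_ ?_
  · intro k σ' hk ha hck hI
    obtain ⟨i, rfl⟩ : ∃ i : Fin n, (i : ℕ) = k := ⟨⟨k, hk⟩, rfl⟩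
    have h3 : σ'.nat 3 = σ₁.nat 3 := ha.1 3 rfl
    refine runs_query hv ?_
    rw [answer_eq (i := i) (by simpa using hck), h3, hS]
    intro i' hi'
    simp only [NExpr.eval, hck, Store.num_setNat, Store.num_setNum_self]
    by_cases hii : i' = i
    · rw [hii, Function.update_self]
    · have hne : (i' : ℕ) ≠ i := fun h => hii (Fin.ext h)
      rw [Function.update_of_ne hne]
      exact hI i' (by omega)
  · exact fun σ' _ hI i => hI i i.2

/-- Here `V` is formed with the old thresholds. Updating in place is sound because the test for
agent `i` reads only cell `i`, which has not been touched before. -/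
theorem runs_updateThresholds {c r : ℚ} (hv : OracleBounded len B v) (hn : σ.nat 0 0 = n)
    (hm : σ.nat 1 0 = m) (hA : ∀ i : Fin n, σ.nat 5 i = if i ∈ active v then 1 else 0)
    (hc : len c ≤ B) (hr : len r ≤ B) (hcτ : ∀ i : Fin n, len (c * σ.num 0 i) ≤ B)
    (hrτ : ∀ i : Fin n, len (r * σ.num 0 i) ≤ B) {V : Finset (Fin n)}
    (hV : V = unsatisfied c v (fun i => σ.num 0 i) (bundleOf (σ.nat 2)))
    (hQ : ∀ σ', Agree (updateThresholds c r) σ σ' →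
      (∀ i : Fin n, σ'.num 0 i = if i ∈ V then r * σ.num 0 i else σ.num 0 i) →
      (σ'.nat 9 0 = 1 ∧ V.Nonempty ∨ σ'.nat 9 0 = 0 ∧ V = ∅) → Q σ') :
    Runs len B v (updateThresholds c r) σ Q := by
  suffices H : Runs len B v (updateThresholds c r) σ fun σ' =>
      (∀ i : Fin n, σ'.num 0 i = if i ∈ V then r * σ.num 0 i else σ.num 0 i) ∧
      (σ'.nat 9 0 = 1 ∧ V.Nonempty ∨ σ'.nat 9 0 = 0 ∧ V = ∅) from
    H.weaken fun σ' ha h => hQ σ' ha h.1 h.2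
  refine runs_seq (runs_setNat (Nat.zero_le _) ?_)
  refine runs_forLoop (N := n) rfl rfl (by decide) (by simpa using hn)
    (fun k σ' => (∀ i : Fin n, i < k →
        σ'.num 0 i = if i ∈ V then r * σ.num 0 i else σ.num 0 i) ∧
      (∀ i : Fin n, k ≤ i → σ'.num 0 i = σ.num 0 i) ∧
      (σ'.nat 9 0 = 1 ∧ V.Nonempty ∨ σ'.nat 9 0 = 0 ∧ ∀ i ∈ V, k ≤ i)) ?_ ?_ ?_
  · simp
  · rintro k σ' hk ha hck ⟨hI₁, hI₂, hI₃⟩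
    obtain ⟨i, rfl⟩ : ∃ i : Fin n, (i : ℕ) = k := ⟨⟨k, hk⟩, rfl⟩
    have h1 : σ'.nat 1 0 = m := by rw [ha.1 1 rfl]; simpa using hm
    have h2 : σ'.nat 2 = σ.nat 2 := by rw [ha.1 2 rfl]; simp
    have h5 : σ'.nat 5 = σ.nat 5 := by rw [ha.1 5 rfl]; simp
    have hτi := hI₂ i le_rfl
    -- what is left to show when agent `i` is not in `V`
    have hskip : ∀ σ₂ : Store, σ₂.nat 9 = σ'.nat 9 → σ₂.num 0 = σ'.num 0 → i ∉ V →
        (∀ i' : Fin n, i' < (i + 1 : ℕ) → (σ₂.setNat 7 0 (i + 1)).num 0 i' =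
          if i' ∈ V then r * σ.num 0 i' else σ.num 0 i') ∧
        (∀ i' : Fin n, (i + 1 : ℕ) ≤ i' →
          (σ₂.setNat 7 0 (i + 1)).num 0 i' = σ.num 0 i') ∧
        ((σ₂.setNat 7 0 (i + 1)).nat 9 0 = 1 ∧ V.Nonempty ∨
          (σ₂.setNat 7 0 (i + 1)).nat 9 0 = 0 ∧ ∀ i' ∈ V, (i + 1 : ℕ) ≤ i') := by
      intro σ₂ h9 h0 hiV
      simp only [Store.num_setNat, h0, ne_eq, not_false_eq_true, Nat.reduceEqDiff,
        Store.nat_setNat_of_ne, h9]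
      refine ⟨fun i' hi' => ?_, fun i' hi' => hI₂ i' (by omega), hI₃.imp_right fun h =>
        ⟨h.1, fun i' hi' => ?_⟩⟩
      · by_cases hii : i' = i
        · rw [hii, if_neg hiV, hτi]
        · have hne : (i' : ℕ) ≠ i := fun h => hii (Fin.ext h)
          exact hI₁ i' (by omega)
      · have hne : (i' : ℕ) ≠ i := fun h => hiV (Fin.ext h ▸ hi')
        have := h.2 i' hi'
        omega
    refine runs_ite trivial (fun hb => ?_) fun hb => runs_skip (hskip _ rfl rfl ?_)
    swap
    · intro hiV
      rw [hV, mem_unsatisfied] at hiV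
      have h5i := hA i
      rw [if_pos hiV.1] at h5i
      exact hb (by simp [Test.holds, hck, h5, h5i])
    have hi : i ∈ active v := by
      by_contra hno
      have h5i := hA i
      rw [if_neg hno] at h5i
      simp [Test.holds, hck, h5, h5i] at hb
    refine runs_seq (runs_loadBundle hv h1 hck fun σ₂ ha₂ hs => ?_)
    have h27 : σ₂.nat 7 0 = i := by rw [ha₂.1 7 rfl]; exact hck
    have h29 : σ₂.nat 9 = σ'.nat 9 := ha₂.1 9 rfl
    have h2τ : σ₂.num 0 = σ'.num 0 := ha₂.2 0 rfl
    have hgoods : (goodsOf (σ₂.nat 3) : Finset (Fin m)) = bundleOf (σ.nat 2) i := by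
      ext j
      rw [mem_bundleOf, goodsOf, Finset.mem_filter, hs j j.2, h2]
      by_cases h : σ.nat 2 j = i <;> simp [h]
    refine runs_seq (runs_query hv ?_)
    rw [answer_eq (i := i) (by simpa using h27), hgoods]
    refine runs_ite ⟨⟨hc, trivial, ?_⟩, trivial⟩ (fun hb' => runs_skip (hskip _ ?_ ?_ ?_))
      fun hb' => ?_
    · simpa [h27, h2τ, hτi] using hcτ i
    · simpa using h29
    · simpa using h2τ
    · have hb' : c * σ.num 0 i ≤ v i (bundleOf (σ.nat 2) i) := by
        simpa [Test.holds, h27, h2τ, hτi] using hb'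
      rw [hV, mem_unsatisfied]
      exact fun h => h.2.not_ge hb'
    · have hb' : v i (bundleOf (σ.nat 2) i) < c * σ.num 0 i := by
        simpa [Test.holds, h27, h2τ, hτi] using hb'
      have hiV : i ∈ V := by
        rw [hV, mem_unsatisfied]
        exact ⟨hi, hb'⟩
      refine runs_seq (runs_setNum ⟨hr, trivial, ?_⟩ (fun _ => ?_) (runs_setNat hv.one ?_))
      · simpa [h27, h2τ, hτi] using hrτ i
      · simpa [h27, h2τ, hτi] using hrτ i
      · simp only [RExpr.eval, NExpr.eval, Store.num_setNat, Store.num_setNum_self,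
          Store.nat_setNum, h27, ne_eq, not_false_eq_true, Nat.reduceEqDiff, zero_ne_one,
          one_ne_zero, Store.num_setNum_of_ne, h2τ, hτi, Store.nat_setNat_of_ne,
          Store.nat_setNat_self, Function.update_self]
        refine ⟨fun i' hi' => ?_, fun i' hi' => ?_, Or.inl ⟨trivial, i, hiV⟩⟩
        · by_cases hii : i' = i
          · rw [hii, if_pos hiV, Function.update_self]
          · have hne : (i' : ℕ) ≠ i := fun h => hii (Fin.ext h)
            rw [Function.update_of_ne hne]
            exact hI₁ i' (by omega)
        · rw [Function.update_of_ne (by omega)]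
          exact hI₂ i' (by omega)
  · rintro σ' - ⟨hI₁, -, hI₃⟩
    refine ⟨fun i => hI₁ i i.2, hI₃.imp_right fun h => ⟨h.1, ?_⟩⟩
    exact Finset.eq_empty_of_forall_notMem fun i hi => (h.2 i hi).not_gt i.2

/-- While flag `9` is 1, the number of loop iterations of the program equals that of AlgSub. One
extra pass finds `V` empty and clears the flag; the strict bound `k < B` leaves room for it. -/
theorem runs_algSubLoop {c r : ℚ} {δ : ℝ} (hv : OracleBounded len B v)
    (hv₀ : ∀ i S, 0 ≤ v i S) (hn₁ : 1 ≤ n) (hrδ : (r : ℝ) = 1 / (1 + δ)) (hc : len c ≤ B)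
    (hr : len r ≤ B)
    (hreach : ∀ k τ P, Reaches c δ v k τ P → k < B ∧
      ∀ i, len (c * τ i) ≤ B ∧ len (r * τ i) ≤ B)
    (hn : σ.nat 0 0 = n) (hm : σ.nat 1 0 = m)
    (hA : ∀ i : Fin n, σ.nat 5 i = if i ∈ active v then 1 else 0) (h9 : σ.nat 9 0 = 1)
    (hτ : ∀ i : Fin n, σ.num 0 i = v i Finset.univ) (ho : ∀ j < m, σ.nat 2 j = n)
    (hQ : ∀ σ', Agree (algSubLoop c r) σ σ' →
      (∃ k τ, Reaches c δ v k τ (bundleOf (σ'.nat 2)) ∧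
        unsatisfied c v τ (bundleOf (σ'.nat 2)) = ∅) → Q σ') :
    Runs len B v (algSubLoop c r) σ Q := by
  refine runs_loop (fun t σ' =>
    (σ'.nat 9 0 = 1 ∧ Reaches c δ v t (fun i => σ'.num 0 i) (bundleOf (σ'.nat 2))) ∨
    σ'.nat 9 0 = 0 ∧ ∃ k τ, Reaches c δ v k τ (bundleOf (σ'.nat 2)) ∧
        unsatisfied c v τ (bundleOf (σ'.nat 2)) = ∅) ?_ (fun _ _ _ => trivial) ?_ ?_ ?_
  · refine Or.inl ⟨h9, ?_⟩
    rw [bundleOf_congr ho, bundleOf_const, show (fun i : Fin n => σ.num 0 i) = fun i =>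
      v i Finset.univ from funext hτ]
    exact .start
  · rintro t σ' - hI hb
    have hb : 1 ≤ σ'.nat 9 0 := hb
    obtain ⟨-, h⟩ := hI.resolve_right fun h => by omega
    exact (hreach _ _ _ h).1
  · intro t σ' ha hI hb
    have hb : 1 ≤ σ'.nat 9 0 := hb
    obtain ⟨-, h⟩ := hI.resolve_right fun h => by omega
    have h0 : σ'.nat 0 0 = n := by rw [ha.1 0 rfl]; exact hn
    have h1 : σ'.nat 1 0 = m := by rw [ha.1 1 rfl]; exact hm
    have h5 : σ'.nat 5 = σ.nat 5 := ha.1 5 rfl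
    have hlen := (hreach _ _ _ h).2
    refine runs_seq (runs_updateThresholds hv h0 h1 (by simpa [h5] using hA) hc hr
      (fun i => (hlen i).1) (fun i => (hlen i).2) rfl fun σ₂ ha₂ hτ₂ hflag => ?_)
    have h22 : σ₂.nat 2 = σ'.nat 2 := ha₂.1 2 rfl
    refine runs_ite trivial (fun hb₂ => ?_) fun hb₂ => runs_skip ?_
    · have hb₂ : 1 ≤ σ₂.nat 9 0 := hb₂
      obtain ⟨h29, hV⟩ := hflag.resolve_right fun h => by omega
      have hnext : ∀ P, RoundRobin c v (active v) (fun i => σ₂.num 0 i) P →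
          Reaches c δ v (t + 1) (fun i => σ₂.num 0 i) P := fun P hP =>
        .iterate t _ _ _ P h hV (fun i hi => by rw [hτ₂, if_pos hi, hrδ])
          (fun i hi => by rw [hτ₂, if_neg hi]) hP
      -- The lengths of the new thresholds must be bounded before RoundRobin has run. Any possible
      -- result makes these thresholds reachable, so `hreach` applies to them.
      obtain ⟨P, hP⟩ := exists_roundRobin c hv₀ hn₁ (active v) fun i => σ₂.num 0 i
      refine runs_roundRobin hv hv₀ hn₁ (by rw [ha₂.1 0 rfl]; exact h0)
        (by rw [ha₂.1 1 rfl]; exact h1) (A := active v)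
        (by rw [ha₂.1 5 rfl, h5]; exact hA) hc
        (fun i => ((hreach _ _ _ (hnext P hP)).2 i).1) fun σ₃ ha₃ _ hP₃ => Or.inl ⟨?_, ?_⟩
      · rw [ha₃.1 9 rfl, h29]
      · rw [ha₃.2 0 rfl]
        exact hnext _ hP₃
    · have hb₂ : ¬ 1 ≤ σ₂.nat 9 0 := hb₂
      obtain ⟨h29, hV⟩ := hflag.resolve_left fun h => by omega
      refine Or.inr ⟨h29, t, fun i => σ'.num 0 i, ?_, ?_⟩
      · rw [h22]
        exact h
      · rw [h22]
        exact hV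
  · rintro t σ' ha hI hb
    have hb : ¬ 1 ≤ σ'.nat 9 0 := hb
    exact hQ σ' ha (hI.resolve_left fun h => by omega).2

theorem runs_algSub {c r : ℚ} {δ : ℝ} (hv : OracleBounded len B v)
    (hval : ∀ i, IsValuation (v i)) (hn₁ : 1 ≤ n) (hrδ : (r : ℝ) = 1 / (1 + δ))
    (hc : len c ≤ B) (hr : len r ≤ B)
    (hreach : ∀ k τ P, Reaches c δ v k τ P → k < B ∧
      ∀ i, len (c * τ i) ≤ B ∧ len (r * τ i) ≤ B) :
    Runs len B v (algSub c r) (initial n m) fun σ' => (∀ j < m, σ'.nat 2 j < n) ∧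
      Returns c δ v (bundleOf (σ'.nat 2)) := by
  refine runs_seq (runs_clearOwners hv (by simp [initial]) (by simp [initial])
    fun σ₁ ha₁ ho₁ => ?_)
  have h10 : σ₁.nat 0 0 = n := by rw [ha₁.1 0 rfl]; simp [initial]
  have h11 : σ₁.nat 1 0 = m := by rw [ha₁.1 1 rfl]; simp [initial]
  refine runs_seq (runs_findActive hv hval hn₁ h10 h11 (by rw [ha₁.1 3 rfl]; simp [initial])
    fun σ₂ ha₂ hA => ?_)
  have h20 : σ₂.nat 0 0 = n := by rw [ha₂.1 0 rfl]; exact h10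
  have h21 : σ₂.nat 1 0 = m := by rw [ha₂.1 1 rfl]; exact h11
  refine runs_seq (runs_initThresholds hv h20 h21 fun σ₃ ha₃ hτ => ?_)
  have h30 : σ₃.nat 0 0 = n := by rw [ha₃.1 0 rfl]; exact h20
  have h31 : σ₃.nat 1 0 = m := by rw [ha₃.1 1 rfl]; exact h21
  have h32 : σ₃.nat 2 = σ₁.nat 2 := (ha₃.1 2 rfl).trans (ha₂.1 2 rfl)
  have h35 : σ₃.nat 5 = σ₂.nat 5 := ha₃.1 5 rfl
  refine runs_seq (runs_setNat hv.one (runs_seq (runs_algSubLoop hv (fun i => (hval i).nonneg) hn₁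
    hrδ hc hr hreach (by simpa using h30) (by simpa using h31) (by simpa [h35] using hA)
    (by simp) (by simpa using hτ) (by simpa [h32] using ho₁) fun σ₄ ha₄ h => ?_)))
  have h40 : σ₄.nat 0 0 = n := by rw [ha₄.1 0 rfl]; simpa using h30
  have h41 : σ₄.nat 1 0 = m := by rw [ha₄.1 1 rfl]; simpa using h31
  obtain ⟨k, τ, hk, hV⟩ := h
  exact runs_fillOwners hv hn₁ h40 h41 fun σ₅ _ hlt hpart hsub =>
    ⟨hlt, k, τ, _, hk, hV, hpart, hsub⟩

/-- The program halts within its time bound and outputs an allocation that AlgSub can return. -/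
theorem outputs_algSub {c r : ℚ} {δ : ℝ} (hv : OracleBounded len B v)
    (hval : ∀ i, IsValuation (v i)) (hn₁ : 1 ≤ n) (hrδ : (r : ℝ) = 1 / (1 + δ))
    (hc : len c ≤ B) (hr : len r ≤ B)
    (hreach : ∀ k τ P, Reaches c δ v k τ P → k < B ∧
      ∀ i, len (c * τ i) ≤ B ∧ len (r * τ i) ≤ B) :
    ∃ P T, Outputs len v (algSub c r) P T ∧ Returns c δ v P ∧ T ≤ (algSub c r).timeBound B := by
  obtain ⟨σ, T, hexec, hT, -, hlt, hret⟩ := runs_algSub hv hval hn₁ hrδ hc hr hreach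
    (⟨fun x k => by
      have h1 := hv.agents
      have h2 := hv.goods
      simp only [initial]
      split_ifs <;> omega, fun _ _ => hv.zero⟩ : (initial n m).Bounded len B)
  refine ⟨_, T, ⟨σ, hexec, fun j => ⟨⟨σ.nat 2 j, hlt j j.2⟩, rfl, fun k => ?_⟩⟩, hret, hT⟩
  rw [mem_bundleOf, Fin.ext_iff, eq_comm]

end Correctness

/-! ### Lengths of rational numbers -/

theorem natSize_mul_le (a b : ℕ) : Nat.size (a * b) ≤ Nat.size a + Nat.size b := by
  rw [Nat.size_le, pow_add]
  exact Nat.mul_lt_mul'' (Nat.lt_size_self a) (Nat.lt_size_self b)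

theorem ratLen_mul_le (a b : ℚ) : ratLen (a * b) ≤ ratLen a + ratLen b := by
  have h₁ : Nat.size (a * b).num.natAbs ≤ Nat.size a.num.natAbs + Nat.size b.num.natAbs := by
    refine le_trans (Nat.size_le_size ?_) (natSize_mul_le _ _)
    rw [Rat.num_mul, ← Int.natAbs_mul]
    exact Int.natAbs_ediv_le_natAbs _ _
  have h₂ : Nat.size (a * b).den ≤ Nat.size a.den + Nat.size b.den := by
    refine le_trans (Nat.size_le_size ?_) (natSize_mul_le _ _)
    rw [Rat.den_mul]
    exact Nat.div_le_self _ _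
  unfold ratLen
  omega

theorem ratLen_pow_mul_le (r q : ℚ) (e : ℕ) : ratLen (r ^ e * q) ≤ e * ratLen r + ratLen q := by
  induction e with
  | zero => simp
  | succ e ih =>
    rw [pow_succ', mul_assoc]
    have := ratLen_mul_le r (r ^ e * q)
    rw [Nat.add_mul]
    omega

/-- `bitLen` uses a chosen rational preimage; injectivity of the cast makes it `q`. -/
theorem bitLen_ratCast (q : ℚ) : bitLen (q : ℝ) = ratLen q := by
  have h : ∃ q' : ℚ, (q' : ℝ) = q := ⟨q, rfl⟩
  unfold bitLen
  rw [dif_pos h, Rat.cast_injective h.choose_spec]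

theorem ratCast_le_two_pow {q : ℚ} {L : ℕ} (h : ratLen q ≤ L) : (q : ℝ) ≤ 2 ^ L := by
  have h₁ : q.num.natAbs < 2 ^ L := Nat.size_le.1 ((Nat.le_add_right _ _).trans h)
  have h₂ : |q| ≤ (q.num.natAbs : ℚ) := by
    rw [Rat.abs_def, Rat.divInt_eq_div, Int.cast_natCast, Int.cast_natCast]
    exact div_le_self (Nat.cast_nonneg _) (by exact_mod_cast q.pos)
  have h₃ : q ≤ ((2 ^ L : ℕ) : ℚ) :=
    (le_abs_self q).trans (h₂.trans (by exact_mod_cast h₁.le))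
  exact_mod_cast h₃

theorem one_le_two_pow_mul {q : ℚ} {L : ℕ} (h : ratLen q ≤ L) (hq : 0 < q) :
    (1 : ℝ) ≤ 2 ^ L * q := by
  have h₁ : q.den < 2 ^ L := Nat.size_le.1 ((Nat.le_add_left _ _).trans h)
  have h₂ : (1 : ℚ) ≤ q.den * q := by
    rw [Rat.den_mul_eq_num]
    exact_mod_cast Rat.num_pos.2 hq
  have h₃ : (1 : ℚ) ≤ ((2 ^ L : ℕ) : ℚ) * q :=
    h₂.trans (mul_le_mul_of_nonneg_right (by exact_mod_cast h₁.le) hq.le)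
  exact_mod_cast h₃

/-! ### Iteration bounds, choice of the size parameter, and conclusion -/

section Main

variable {n m : ℕ} {v : Fin n → Finset (Fin m) → ℝ}

/-- The parameter of the running time on a real RAM. -/
noncomputable def logSum (v : Fin n → Finset (Fin m) → ℝ) : ℕ :=
  ∑ i ∈ active v, ⌈Real.logb 2 (v i Finset.univ / share v i)⌉₊

/-- Change of base to 2, with `κ` an integer bound for the conversion factor; the summands 1
contribute at most `n`. -/
theorem Reaches.le_logSum (hn : 1 ≤ n) (hv : ∀ i, IsValuation (v i)) {c δ : ℝ} (hc₀ : 0 ≤ c)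
    (hc : c ≤ 1 / 3) (hδ : 0 < δ) {κ : ℕ} (hκ : (Real.logb 2 (1 + δ))⁻¹ ≤ κ) {k : ℕ}
    {τ : Fin n → ℝ} {P : Fin n → Finset (Fin m)} (h : Reaches c δ v k τ P) :
    k ≤ n + κ * logSum v := by
  have hlog : 0 < Real.logb 2 (1 + δ) := Real.logb_pos (by norm_num) (by linarith)
  have hreal : (k : ℝ) ≤ n + κ * logSum v := by
    refine (h.le_sum_logb hn hv hc₀ hc hδ).trans ?_
    rw [Finset.sum_add_distrib, logSum, Nat.cast_sum, Finset.mul_sum, Finset.sum_const,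
      nsmul_eq_mul, mul_one]
    refine add_le_add ?_ (Finset.sum_le_sum fun i _ => ?_)
    · have := Finset.card_le_univ (active v)
      rw [Fintype.card_fin] at this
      exact_mod_cast this
    · set x := v i Finset.univ / share v i
      have hx : Real.logb (1 + δ) x = (Real.logb 2 (1 + δ))⁻¹ * Real.logb 2 x := by
        rw [Real.logb, Real.logb, Real.logb, inv_div]
        have h2 : Real.log 2 ≠ 0 := (Real.log_pos (by norm_num)).ne'
        field_simp
      rw [hx]
      calc (Real.logb 2 (1 + δ))⁻¹ * Real.logb 2 x
          ≤ (Real.logb 2 (1 + δ))⁻¹ * (⌈Real.logb 2 x⌉₊ : ℝ) := by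
            gcongr
            exact Nat.le_ceil _
        _ ≤ κ * (⌈Real.logb 2 x⌉₊ : ℝ) := by gcongr
  exact_mod_cast hreal

/-- The share is itself a value of the valuation, so it also has at most `L` bits. Positive
rationals of `L` bits lie between `2^(-L)` and `2^L`, hence each ratio is at most `2^(2L)`. -/
theorem logSum_le (hn : 1 ≤ n) (hv : ∀ i, IsValuation (v i)) {L : ℕ}
    (hL : ∀ i S, ∃ q : ℚ, v i S = q ∧ ratLen q ≤ L) : logSum v ≤ n * (2 * L) := by
  calc logSum v ≤ ∑ _i ∈ active v, 2 * L := Finset.sum_le_sum fun i hi => ?_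
    _ = (active v).card * (2 * L) := by rw [Finset.sum_const, smul_eq_mul]
    _ ≤ n * (2 * L) := Nat.mul_le_mul_right _ (by simpa using Finset.card_le_univ (active v))
  rw [Nat.ceil_le]
  have hμ := mem_active.1 hi
  obtain ⟨S, hS⟩ := exists_eq_maximinShare hn (v i)
  obtain ⟨q, hq, hqL⟩ := hL i Finset.univ
  obtain ⟨q', hq', hqL'⟩ := hL i S
  have hshare : share v i = q' := hS.trans hq'
  have hq'₀ : 0 < q' := by
    rw [hshare] at hμ
    exact_mod_cast hμ
  have h₁ := ratCast_le_two_pow hqL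
  have h₂ := one_le_two_pow_mul hqL' hq'₀
  rw [hshare] at hμ
  rw [hq, hshare]
  have hq₀ : (0 : ℝ) < q := by
    rw [← hq]
    exact (mem_active.1 hi).trans_le (maximinShare_le_univ hn (hv i))
  rw [Real.logb_le_iff_le_rpow (by norm_num) (by positivity), div_le_iff₀ hμ, Real.rpow_natCast,
    two_mul, pow_add, mul_assoc]
  exact h₁.trans (le_mul_of_one_le_right (by positivity) h₂)

theorem algSubFinds {c δ : ℚ} {ρ : ℝ} (hc₀ : (0 : ℝ) ≤ c) (hc : (c : ℝ) ≤ 1 / 3)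
    (hδ : (0 : ℝ) < δ) (hρ₀ : 0 ≤ ρ) (hρ : ρ * (1 + δ) ≤ c) : AlgSubFinds c δ ρ := by
  classical
  refine ⟨fun n m v hn hv => ⟨fun k τ P h => ⟨h.le_sum_logb hn hv hc₀ hc hδ, fun hV => ?_⟩,
    fun P h => h.spec hn hv hc₀ hc hδ hρ₀ hρ⟩, ?_⟩
  · obtain ⟨P', hP'⟩ := exists_roundRobin c (fun i => (hv i).nonneg) hn (active v)
      fun i => if i ∈ unsatisfied c v τ P then 1 / (1 + δ) * τ i else τ i
    exact ⟨_, P', .iterate k τ _ P P' h hV (fun i hi => if_pos hi) (fun i hi => if_neg hi) hP'⟩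
  set r : ℚ := 1 / (1 + δ) with hr
  have hrδ : (r : ℝ) = 1 / (1 + δ) := by rw [hr]; push_cast; rfl
  obtain ⟨κ, hκ⟩ := exists_nat_ge (Real.logb 2 (1 + (δ : ℝ)))⁻¹
  obtain ⟨C, d, hCd⟩ := (algSub c r).polyBounded_timeBound
  -- A generous constant, depending only on `c` and `δ`, that gives `B + 1 ≤ C₁ * X ^ 2` in both
  -- machine models.
  set C₁ := 8 * (κ + 1) * (ratLen r + 1) * (ratLen c + 1) with hC₁
  have hfin : ∀ X B T : ℕ, T ≤ (algSub c r).timeBound B → B + 1 ≤ C₁ * X ^ 2 →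
      T ≤ C * C₁ ^ d * X ^ (2 * d) := fun X B T hT hB => by
    calc T ≤ C * (B + 1) ^ d := hT.trans (hCd B)
      _ ≤ C * (C₁ * X ^ 2) ^ d := by gcongr
      _ = C * C₁ ^ d * X ^ (2 * d) := by rw [mul_pow, ← pow_mul, mul_assoc]
  refine ⟨algSub c r, C * C₁ ^ d, 2 * d, fun n m v hn hv => ?_, fun n m L v hn hv hL => ?_⟩
  · set S := ∑ i ∈ active v, ⌈Real.logb 2 (v i Finset.univ / share v i)⌉₊ with hS
    obtain ⟨P, T, hout, hret, hT⟩ := outputs_algSub (len := fun _ => 1)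
      (B := n + m + (n + κ * S) + 1) (v := v) (c := c) (r := r) (δ := δ)
      ⟨fun _ _ => by omega, by omega, by omega, by omega, by omega⟩ hv hn hrδ (by omega) (by omega)
      fun k τ P h => by
        have := h.le_logSum hn hv hc₀ hc hδ hκ
        rw [logSum, ← hS] at this
        exact ⟨by omega, fun i => ⟨by omega, by omega⟩⟩
    refine ⟨P, T, hout, hret, hfin _ _ _ hT ?_⟩
    have h₁ : κ * S ≤ κ * (n + m + S + 1) := by gcongr; omega
    have h₂ : n + m + (n + κ * S) + 1 + 1 ≤ 8 * (κ + 1) * (n + m + S + 1) := by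
      have : 8 * (κ + 1) * (n + m + S + 1) =
        8 * (κ * (n + m + S + 1)) + 8 * (n + m + S + 1) := by ring
      omega
    refine h₂.trans (Nat.mul_le_mul ?_ (Nat.le_self_pow (by decide) _))
    rw [hC₁, mul_assoc (8 * (κ + 1))]
    exact Nat.le_mul_of_pos_right _ (by positivity)
  · set K := n + κ * (n * (2 * L)) with hK
    -- `K` bounds the iterations and hence the exponents, so a threshold has at most `K * ratLen r +
    -- L` bits; the remaining terms cover a multiplication by `c` or `r`.
    set B := n + m + L + K + K * ratLen r + ratLen r + ratLen c + 1 with hB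
    have hlen : ∀ (a : ℚ) (e : ℕ) (i : Fin n), e ≤ K → ratLen a ≤ ratLen r + ratLen c →
        bitLen (a * ((1 / (1 + δ)) ^ e * v i Finset.univ)) ≤ B := by
      intro a e i he ha
      obtain ⟨q, hq, hqL⟩ := hL i Finset.univ
      rw [hq, ← hrδ, show (a : ℝ) * ((r : ℝ) ^ e * q) = ((a * (r ^ e * q) : ℚ) : ℝ) by
        push_cast; rfl, bitLen_ratCast]
      have h₁ := ratLen_mul_le a (r ^ e * q)
      have h₂ := ratLen_pow_mul_le r q e
      have h₃ : e * ratLen r ≤ K * ratLen r := Nat.mul_le_mul_right _ he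
      omega
    have hzero : bitLen 0 ≤ B := by
      have h₀ : bitLen ((0 : ℚ) : ℝ) = 1 := by
        rw [bitLen_ratCast]
        simp [ratLen]
      rw [Rat.cast_zero] at h₀
      omega
    obtain ⟨P, T, hout, hret, hT⟩ := outputs_algSub (len := bitLen)
      (B := B) (v := v) (c := c) (r := r) (δ := δ)
      ⟨fun i A => by
        obtain ⟨q, hq, hqL⟩ := hL i A
        rw [hq, bitLen_ratCast]
        omega, hzero, by omega, by omega, by omega⟩ hv hn hrδ
      (by rw [bitLen_ratCast]; omega) (by rw [bitLen_ratCast]; omega)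
      fun k τ P h => by
        have hk : k ≤ K := (h.le_logSum hn hv hc₀ hc hδ hκ).trans (by
          rw [hK]
          gcongr
          exact logSum_le hn hv hL)
        obtain ⟨-, -, e, he, hek, -⟩ := h.spec hn hv hc₀ hc hδ
        refine ⟨by omega, fun i => ?_⟩
        rw [he i]
        exact ⟨hlen c _ i ((hek i).trans hk) (by omega), hlen r _ i ((hek i).trans hk) (by omega)⟩
    refine ⟨P, T, hout, hret, hfin _ _ _ hT ?_⟩
    set X := n + m + L + 1
    have hX : 1 ≤ X := by omega
    have hX₂ : X ≤ X ^ 2 := Nat.le_self_pow (by decide) _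
    have hnL : n * L ≤ X ^ 2 := by
      rw [sq]
      exact Nat.mul_le_mul (by omega) (by omega)
    have hKX : K ≤ 2 * (κ + 1) * X ^ 2 := by
      calc K = n + 2 * κ * (n * L) := by rw [hK]; ring
        _ ≤ X ^ 2 + 2 * κ * X ^ 2 := Nat.add_le_add (by omega) (Nat.mul_le_mul_left _ hnL)
        _ ≤ 2 * (κ + 1) * X ^ 2 := by
          have : 2 * (κ + 1) * X ^ 2 = 2 * X ^ 2 + 2 * κ * X ^ 2 := by ring
          omega
    calc B + 1 = (X + 1) + K * (ratLen r + 1) + (ratLen r + ratLen c) := by rw [hB]; ring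
      _ ≤ (X ^ 2 + X ^ 2) + 2 * (κ + 1) * X ^ 2 * (ratLen r + 1) +
          (ratLen r + ratLen c) * X ^ 2 :=
        Nat.add_le_add (Nat.add_le_add (by omega) (Nat.mul_le_mul_right _ hKX))
          (Nat.le_mul_of_pos_right _ (by positivity))
      _ = (2 + 2 * (κ + 1) * (ratLen r + 1) + (ratLen r + ratLen c)) * X ^ 2 := by ring
      _ ≤ C₁ * X ^ 2 := by
        gcongr
        rw [hC₁]
        generalize ratLen r = a
        generalize ratLen c = b
        have h₁ : 8 * (κ + 1) * (a + 1) * (b + 1) = 8 + 8 * κ + 8 * a + 8 * (κ * a) + 8 * b +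
          8 * (κ * b) + 8 * (a * b) + 8 * (κ * a * b) := by ring
        have h₂ : 2 * (κ + 1) * (a + 1) = 2 + 2 * κ + 2 * a + 2 * (κ * a) := by ring
        omega

end Main

end MMS

theorem theorem3 :
    -- AlgSub, for every sufficiently small step: factor 1/10
    (∃ δ₀ : ℚ, 0 < δ₀ ∧ δ₀ < 1 ∧ ∀ δ : ℚ, 0 < δ → δ ≤ δ₀ →
      MMS.AlgSubFinds ((1 + δ) / 10) δ (1 / 10)) ∧
    -- AlgSub with the plain factor 1/10 in its tests, for every step
    (∀ δ : ℚ, 0 < δ → δ < 1 → MMS.AlgSubFinds (1 / 10) δ (1 / (10 * (1 + δ)))) ∧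
    -- a 1/10-approximate maximin fair allocation always exists
    (∀ (n m : ℕ) (v : Fin n → Finset (Fin m) → ℝ), 1 ≤ n → (∀ i, MMS.IsValuation (v i)) →
      ∃ P : Fin n → Finset (Fin m), MMS.IsPartition Finset.univ P ∧
        ∀ i, 1 / 10 * MMS.share v i ≤ v i (P i)) := by
  -- For `δ ≤ 1/2` the factor is at most 3/20, well below the required 1/3.
  have hfirst : ∀ δ : ℚ, 0 < δ → δ ≤ 1 / 2 → MMS.AlgSubFinds ((1 + δ) / 10) δ (1 / 10) := by
    intro δ hδ hδ'
    have h₁ : (0 : ℝ) < δ := by exact_mod_cast hδ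
    have h₂ : (δ : ℝ) ≤ ((1 / 2 : ℚ) : ℝ) := Rat.cast_le.2 hδ'
    push_cast at h₂
    refine MMS.algSubFinds ?_ ?_ h₁ (by norm_num) ?_ <;> push_cast <;> linarith
  refine ⟨⟨1 / 2, by norm_num, by norm_num, hfirst⟩, fun δ hδ hδ' => ?_, fun n m v hn hv => ?_⟩
  · have h₁ : (0 : ℝ) < δ := by exact_mod_cast hδ
    refine MMS.algSubFinds (by push_cast; norm_num) (by push_cast; norm_num) h₁ (by positivity) ?_
    push_cast
    refine le_of_eq ?_
    field_simp
  -- Existence needs no efficiency: the output of the program for `δ = 1/2` is an allocation that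
  -- AlgSub can return.
  · obtain ⟨hall, p, C, d, hreal, -⟩ := hfirst (1 / 2) (by norm_num) le_rfl
    obtain ⟨P, T, -, hP, -⟩ := hreal n m v hn hv
    exact ⟨P, (hall n m v hn hv).2 P hP⟩
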